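/- Let $G=(V,E)$ be an infinite graph. In the firefighter game on $G$ with budget $f:\{1,2,\dots\}\to\mathbb{R}$, a finite set $B(0)\subset V$ of vertices is initially burning. At each turn $t=1,2,\dots$ the player permanently protects a finite set of non-burning vertices, so that at most $f(t)$ vertices in total are protected by turn $t$; then every unprotected neighbour of a burning vertex starts burning, and burning vertices burn forever. The player contains the fire if from some turn on no new vertex starts burning. A real number $C$ is the critical protection rate of $G$, written $C(G)=C$, if for $f(t)=Ct$ there is a finite initial set $B(0)$ whose fire the player cannot contain, while for every $\varepsilon>0$ and $f(t)=(C+\varepsilon)t$ the player can contain the fire from every finite initial set $B(0)$. Let $\mathbb{Z}$ denote the bi-infinite path ($m,n$ adjacent iff $|m-n|=1$) and $[h]$ the path on $\{1,\dots,h\}$ with consecutive integers adjacent. Let $\Box$ and $\boxtimes$ denote the Cartesian and the strong product of graphs (in $G\boxtimes H$, distinct vertices are adjacent iff in each coordinate they are equal or adjacent). Then for every integer $h\ge 1$, $$C\big((\mathbb{Z}\,\Box\,\mathbb{Z})\boxtimes[h]\big)=\tfrac32 h\qquad\text{and}\qquad C\big((\mathbb{Z}\boxtimes\mathbb{Z})\boxtimes[h]\big)=3h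 .$$ -/

import Mathlib

namespace SimpleGraph

/-- The strong product of two simple graphs: distinct pairs are adjacent when, in each coordinate,
they are equal or adjacent. -/
def strongProd {α β : Type*} (G : SimpleGraph α) (H : SimpleGraph β) : SimpleGraph (α × β) where
  Adj x y := x ≠ y ∧ (x.1 = y.1 ∨ G.Adj x.1 y.1) ∧ (x.2 = y.2 ∨ H.Adj x.2 y.2)
  symm := ⟨fun _ _ h => ⟨h.1.symm, h.2.1.imp Eq.symm SimpleGraph.Adj.symm, h.2.2.imp Eq.symm SimpleGraph.Adj.symm⟩⟩
  loopless := ⟨fun _ h => h.1 rfl⟩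

end SimpleGraph

namespace Firefighter

variable {V : Type*}

/-- `burning G B₀ F t` is the set of vertices burning after turn `t`, for the initial fire `B₀`,
when `F t` is the set of vertices protected during the turns `1, …, t`. In turn `t + 1` the player
protects first; then all unprotected neighbours of burning vertices catch fire. -/
def burning (G : SimpleGraph V) (B₀ : Set V) (F : ℕ → Finset V) : ℕ → Set V
  | 0 => B₀
  | t + 1 => burning G B₀ F t ∪
      {v | v ∉ F (t + 1) ∧ ∃ u ∈ burning G B₀ F t, G.Adj u v}

/-- `F` is a legal play against the initial fire `B₀` with budget `f`: protection is permanent,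
only non-burning vertices get protected, and at most `f t` vertices are protected by turn `t`. -/
structure IsLegalPlay (G : SimpleGraph V) (B₀ : Set V) (f : ℕ → ℝ) (F : ℕ → Finset V) :
    Prop where
  start : F 0 = ∅
  mono : Monotone F
  notBurning : ∀ t, ∀ v ∈ F (t + 1), v ∉ F t → v ∉ burning G B₀ F t
  budget : ∀ t, 1 ≤ t → ((F t).card : ℝ) ≤ f t

/-- The play `F` contains the fire: from some turn on no new vertex starts burning. -/
def Contains (G : SimpleGraph V) (B₀ : Set V) (F : ℕ → Finset V) : Prop :=
  ∃ T, ∀ t, T ≤ t → burning G B₀ F t = burning G B₀ F T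

/-- With budget `f` the player can contain the fire that starts at `B₀`. -/
def Containable (G : SimpleGraph V) (f : ℕ → ℝ) (B₀ : Set V) : Prop :=
  ∃ F : ℕ → Finset V, IsLegalPlay G B₀ f F ∧ Contains G B₀ F

/-- `C` is the critical protection rate of `G`: with budget `C * t` some finite initial fire cannot
be contained, and with budget `(C + ε) * t`, for any `ε > 0`, every finite initial fire can. -/
def IsCriticalProtectionRate (G : SimpleGraph V) (C : ℝ) : Prop :=
  (∃ B₀ : Set V, B₀.Finite ∧ ¬ Containable G (fun t => C * t) B₀) ∧
    ∀ ε : ℝ, 0 < ε → ∀ B₀ : Set V, B₀.Finite → Containable G (fun t => (C + ε) * t) B₀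

/-- The bi-infinite path on the integers: `m` and `n` are adjacent when `|m - n| = 1`. -/
noncomputable abbrev intPath : SimpleGraph ℤ := SimpleGraph.hasse ℤ

end Firefighter

/-! Choose integer coordinates in which an unhindered fire grows like a square: the usual ones on
the strong grid, the rotated pair `z.1 + z.2`, `z.1 - z.2` on the Cartesian grid. `Coordinates`
records that a side of length ℓ has about gℓ/2 vertices and that a large burning part of a side
gains g vertices when it moves one step outwards. Here g = 2h for the strong grid and g = h for the
Cartesian one, so both claims say that the critical rate is 3g/2.

Lower bound. Start from a large burning square and let a rectangle of width w and height ℓ follow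
the four fronts. Its `weight` gains g for every move of a side, so it stays at least g(w + ℓ) up to
a constant. The key is `LargeRun.fast`: at least three sides move at every turn, so w + ℓ grows
forever. At a first turn T where two sides hold, nearly every burning vertex on those sides is
matched by a protected vertex beyond. If the two sides are adjacent, the weight less the two other
sides leaves about g(w + ℓ)/2 protected vertices, more than the budget 3gT/2 allows. If they are
opposite, say east and west, there are two bounds: gℓ at turn T, and one from `stripWeight`, started
at the last turn when north or south held. Their average exceeds the budget.

Upper bound. Wall in the fire by a rectangle whose sides lie at rapidly increasing distances d₁ < d₂
< d₃ < d₄, protecting each wall vertex when the fire might first reach it. The tight moments are the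
arrivals at the second and third walls: at distance d about 3gd/2 vertices are needed, and ε pays
for the lower-order terms. -/

namespace Firefighter

open Set

/-! ### Sides, rectangles and the weight of a fire -/

section Sides

variable {V : Type*}

/-- The vertices with first coordinate `m` and second coordinate in `[a, b]`. -/
def side (p q : V → ℤ) (m a b : ℤ) : Set V := {v | p v = m ∧ a ≤ q v ∧ q v ≤ b}

/-- The vertices with coordinates in `[pl, pr] × [ql, qr]`. -/
def rect (p q : V → ℤ) (pl pr ql qr : ℤ) : Set V :=
  {v | pl ≤ p v ∧ p v ≤ pr ∧ ql ≤ q v ∧ q v ≤ qr}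

/-- The vertices on the boundary of `rect p q pl pr ql qr`. -/
def frame (p q : V → ℤ) (pl pr ql qr : ℤ) : Set V :=
  rect p q pl pr ql qr ∩ {v | p v = pl ∨ p v = pr ∨ q v = ql ∨ q v = qr}

/-- A large set `A` of vertices on a side has, on the next parallel side, at least `g` more
neighbours than it has vertices off the two ends of the side. -/
def SideGrowth (G : SimpleGraph V) (p q : V → ℤ) (g K : ℕ) : Prop :=
  ∀ (m a b : ℤ) (A : Set V), a < b → A ⊆ side p q m a b → K ≤ A.ncard →
    ∃ D : Finset V, (∀ v ∈ D, v ∈ side p q (m + 1) a b ∧ ∃ u ∈ A, G.Adj u v) ∧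
      (A ∩ {v | a < q v ∧ q v < b}).ncard + g ≤ D.card

/-- A side of length `ℓ` has `g * ℓ / 2` vertices, up to a constant. -/
def SideCount (p q : V → ℤ) (g c : ℕ) : Prop :=
  ∀ m a b : ℤ, a ≤ b → (side p q m a b).Finite ∧
    2 * ((side p q m a b).ncard : ℤ) ≤ g * (b - a) + c ∧
    (g : ℤ) * (b - a) ≤ 2 * ((side p q m a b).ncard : ℤ)

/-- The integer functions `x`, `y` are coordinates on `G` in which fire spreads like the squares of
the grid: each of the four sides of a large square gains `g` vertices per turn. -/
structure Coordinates (G : SimpleGraph V) (x y : V → ℤ) (g K c : ℕ) : Prop where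
  lip_fst : ∀ u v, G.Adj u v → |x u - x v| ≤ 1
  lip_snd : ∀ u v, G.Adj u v → |y u - y v| ≤ 1
  east : SideGrowth G x y g K
  west : SideGrowth G (-x) y g K
  north : SideGrowth G y x g K
  south : SideGrowth G (-y) x g K
  count_fst : SideCount x y g c
  count_snd : SideCount y x g c

theorem side_neg_snd (p q : V → ℤ) (m a b : ℤ) : side p (-q) m (-b) (-a) = side p q m a b := by
  ext v; simp only [side, mem_ofPred_eq, Pi.neg_apply]; omega

theorem side_neg_fst (p q : V → ℤ) (m a b : ℤ) : side (-p) q (-m) a b = side p q m a b := by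
  ext v; simp only [side, mem_ofPred_eq, Pi.neg_apply]; omega

theorem rect_neg_fst (p q : V → ℤ) (pl pr ql qr : ℤ) :
    rect (-p) q (-pr) (-pl) ql qr = rect p q pl pr ql qr := by
  ext v; simp only [rect, mem_ofPred_eq, Pi.neg_apply]; omega

theorem rect_swap (p q : V → ℤ) (pl pr ql qr : ℤ) :
    rect q p ql qr pl pr = rect p q pl pr ql qr := by
  ext v; simp only [rect, mem_ofPred_eq]; omega

theorem frame_neg_fst (p q : V → ℤ) (pl pr ql qr : ℤ) :
    frame (-p) q (-pr) (-pl) ql qr = frame p q pl pr ql qr := by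
  ext v; simp only [frame, rect, mem_inter_iff, mem_ofPred_eq, Pi.neg_apply]; omega

theorem frame_swap (p q : V → ℤ) (pl pr ql qr : ℤ) :
    frame q p ql qr pl pr = frame p q pl pr ql qr := by
  ext v; simp only [frame, rect, mem_inter_iff, mem_ofPred_eq]; omega

theorem SideGrowth.neg_snd {G : SimpleGraph V} {p q : V → ℤ} {g K : ℕ}
    (hg : SideGrowth G p q g K) : SideGrowth G p (-q) g K := by
  intro m a b A hab hA hK
  have e : ∀ m, side p (-q) m a b = side p q m (-b) (-a) := fun m => by
    rw [← side_neg_snd p q, neg_neg, neg_neg]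
  obtain ⟨D, hD, hc⟩ := hg m (-b) (-a) A (by omega) (by rwa [← e]) hK
  refine ⟨D, by rwa [e], ?_⟩
  have : {v | a < (-q) v ∧ (-q) v < b} = {v | -b < q v ∧ q v < -a} := by
    ext v; simp only [mem_ofPred_eq, Pi.neg_apply]; omega
  rwa [this]

theorem SideCount.neg_fst {p q : V → ℤ} {g c : ℕ} (hc : SideCount p q g c) :
    SideCount (-p) q g c := by
  intro m a b hab
  have e : side (-p) q m a b = side p q (-m) a b := by
    rw [← side_neg_fst p q, neg_neg]
  rw [e]; exact hc _ _ _ hab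

theorem SideCount.neg_snd {p q : V → ℤ} {g c : ℕ} (hc : SideCount p q g c) :
    SideCount p (-q) g c := by
  intro m a b hab
  have e : side p (-q) m a b = side p q m (-b) (-a) := by
    rw [← side_neg_snd p q, neg_neg, neg_neg]
  have := hc m (-b) (-a) (by omega)
  rw [e]
  rwa [show -a - -b = b - a by ring] at this

/-- With `Coordinates.swap` this generates the symmetries of the square, so later arguments treat
only one choice of sides. -/
theorem Coordinates.reflect {G : SimpleGraph V} {x y : V → ℤ} {g K c : ℕ}
    (h : Coordinates G x y g K c) : Coordinates G (-x) y g K c where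
  lip_fst u v huv := by
    have := h.lip_fst u v huv
    rw [abs_le] at *; simp only [Pi.neg_apply]; omega
  lip_snd := h.lip_snd
  east := h.west
  west := by rw [neg_neg]; exact h.east
  north := h.north.neg_snd
  south := h.south.neg_snd
  count_fst := h.count_fst.neg_fst
  count_snd := h.count_snd.neg_snd

theorem Coordinates.swap {G : SimpleGraph V} {x y : V → ℤ} {g K c : ℕ}
    (h : Coordinates G x y g K c) : Coordinates G y x g K c where
  lip_fst := h.lip_snd
  lip_snd := h.lip_fst
  east := h.north
  west := h.south
  north := h.east
  south := h.west
  count_fst := h.count_snd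
  count_snd := h.count_fst

theorem SideCount.finite {p q : V → ℤ} {g c : ℕ} (hc : SideCount p q g c) (m a b : ℤ) :
    (side p q m a b).Finite := by
  rcases le_or_gt a b with hab | hab
  · exact (hc m a b hab).1
  · refine Set.finite_empty.subset fun v hv => ?_
    simp only [side, mem_ofPred_eq] at hv; omega

theorem SideCount.rect_finite {p q : V → ℤ} {g c : ℕ} (hc : SideCount p q g c)
    (pl pr ql qr : ℤ) : (rect p q pl pr ql qr).Finite := by
  refine ((Set.finite_Icc pl pr).biUnion fun m _ => hc.finite m ql qr).subset fun v hv => ?_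
  simp only [rect, mem_ofPred_eq] at hv
  simp only [mem_iUnion, mem_Icc, side, mem_ofPred_eq]
  exact ⟨p v, ⟨hv.1, hv.2.1⟩, rfl, hv.2.2⟩

/-- The protected vertices in a rectangle plus the burning vertices on its boundary. -/
noncomputable def weight (B : Set V) (F : Finset V) (p q : V → ℤ) (pl pr ql qr : ℤ) : ℕ :=
  ((F : Set V) ∩ rect p q pl pr ql qr).ncard + (B ∩ frame p q pl pr ql qr).ncard

theorem weight_neg_fst (B : Set V) (F : Finset V) (p q : V → ℤ) (pl pr ql qr : ℤ) :
    weight B F (-p) q (-pr) (-pl) ql qr = weight B F p q pl pr ql qr := by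
  simp only [weight, rect_neg_fst, frame_neg_fst]

theorem weight_swap (B : Set V) (F : Finset V) (p q : V → ℤ) (pl pr ql qr : ℤ) :
    weight B F q p ql qr pl pr = weight B F p q pl pr ql qr := by
  simp only [weight, rect_swap p q, frame_swap p q]

theorem weight_mono {B B' : Set V} {F F' : Finset V} {p q : V → ℤ} {pl pr ql qr : ℤ}
    (hfin : (rect p q pl pr ql qr).Finite) (hB : B ∩ rect p q pl pr ql qr ⊆ B') (hF : F ⊆ F') :
    weight B F p q pl pr ql qr ≤ weight B' F' p q pl pr ql qr := by
  refine add_le_add (ncard_le_ncard ?_ (hfin.subset inter_subset_right))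
    (ncard_le_ncard ?_ (hfin.subset fun v hv => hv.2.1))
  · exact inter_subset_inter_left _ (by exact_mod_cast hF)
  · exact fun v hv => ⟨hB ⟨hv.1, hv.2.1⟩, hv.2⟩

/-- Only the interior of the old side leaves the frame; its ends remain, as parts of the
perpendicular sides. The neighbours given by `SideGrowth` replace it: each is burning, hence on the
new frame, or protected, hence newly inside the rectangle. `M` allows for a partly updated fire, as
needed in `Run.weight_step`. -/
theorem weight_extend {G : SimpleGraph V} {p q : V → ℤ} {g K : ℕ} (hg : SideGrowth G p q g K)
    {B M : Set V} {F : Finset V} {pl pr ql qr : ℤ}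
    (hfin : (rect p q pl (pr + 1) ql qr).Finite) (hq : ql < qr) (hp : pl ≤ pr)
    (hU : ∀ u ∈ B, ∀ v ∈ side p q (pr + 1) ql qr, G.Adj u v → v ∈ M ∨ v ∈ F)
    (hK : K ≤ (B ∩ side p q pr ql qr).ncard)
    (hM : ∀ v ∈ M, v ∈ side p q pr ql qr → ql < q v → q v < qr → v ∈ B) :
    weight M F p q pl pr ql qr + g ≤ weight M F p q pl (pr + 1) ql qr := by
  classical
  obtain ⟨D, hD, hc⟩ := hg pr ql qr (B ∩ side p q pr ql qr) hq inter_subset_right hK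
  set A := B ∩ side p q pr ql qr ∩ {v | ql < q v ∧ q v < qr} with hA
  have hsub : rect p q pl pr ql qr ⊆ rect p q pl (pr + 1) ql qr := fun v hv => by
    simp only [rect, mem_ofPred_eq] at *; omega
  have hDr : ∀ v ∈ D, p v = pr + 1 ∧ ql ≤ q v ∧ q v ≤ qr := fun v hv => (hD v hv).1
  have h1 : ((F : Set V) ∩ rect p q pl pr ql qr).ncard + (D.filter (· ∈ F)).card ≤
      ((F : Set V) ∩ rect p q pl (pr + 1) ql qr).ncard := by
    rw [← ncard_coe_finset, ← ncard_union_eq]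
    · refine ncard_le_ncard ?_ (hfin.subset inter_subset_right)
      rintro v (hv | hv)
      · exact ⟨hv.1, hsub hv.2⟩
      · simp only [Finset.coe_filter, mem_ofPred_eq] at hv
        have := hDr v hv.1
        refine ⟨hv.2, ?_⟩
        simp only [rect, mem_ofPred_eq]; omega
    · rw [Set.disjoint_left]
      rintro v hv hv'
      simp only [Finset.coe_filter, mem_ofPred_eq] at hv'
      have := hDr v hv'.1
      have := hv.2
      simp only [rect, mem_ofPred_eq] at this; omega
  have hfr : frame p q pl pr ql qr \ {v | p v = pr ∧ ql < q v ∧ q v < qr} ⊆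
      frame p q pl (pr + 1) ql qr := fun v hv => by
    simp only [frame, rect, mem_sdiff, mem_inter_iff, mem_ofPred_eq] at *; omega
  have hffin : (frame p q pl (pr + 1) ql qr).Finite := hfin.subset inter_subset_left
  have hAfin : A.Finite := hfin.subset fun v hv => by
    have := hv.1.2
    simp only [side, rect, mem_ofPred_eq] at *; omega
  set M₀ := M ∩ (frame p q pl pr ql qr \ {v | p v = pr ∧ ql < q v ∧ q v < qr}) with hM₀
  have hM₀fin : M₀.Finite := hffin.subset (inter_subset_right.trans hfr)
  have h2 : (M ∩ frame p q pl pr ql qr).ncard ≤ M₀.ncard + A.ncard := by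
    refine (ncard_le_ncard ?_ (hM₀fin.union hAfin)).trans (ncard_union_le _ _)
    intro v hv
    by_cases hv' : p v = pr ∧ ql < q v ∧ q v < qr
    · right
      have hs : v ∈ side p q pr ql qr := ⟨hv'.1, hv'.2.1.le, hv'.2.2.le⟩
      exact ⟨⟨hM v hv.1 hs hv'.2.1 hv'.2.2, hs⟩, hv'.2⟩
    · exact Or.inl ⟨hv.1, hv.2, hv'⟩
  have h3 : M₀.ncard + (D.filter (· ∈ M)).card ≤ (M ∩ frame p q pl (pr + 1) ql qr).ncard := by
    rw [← ncard_coe_finset, ← ncard_union_eq ?_ hM₀fin (Finset.finite_toSet _)]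
    · refine ncard_le_ncard ?_ (hffin.subset inter_subset_right)
      rintro v (hv | hv)
      · exact ⟨hv.1, hfr hv.2⟩
      · simp only [Finset.coe_filter, mem_ofPred_eq] at hv
        have := hDr v hv.1
        refine ⟨hv.2, ?_⟩
        simp only [frame, rect, mem_inter_iff, mem_ofPred_eq]; omega
    · rw [Set.disjoint_left]
      rintro v hv hv'
      simp only [Finset.coe_filter, mem_ofPred_eq] at hv'
      have := hDr v hv'.1
      have := hv.2.1.1
      simp only [rect, mem_ofPred_eq] at this; omega
  have h4 : D.card ≤ (D.filter (· ∈ M)).card + (D.filter (· ∈ F)).card := by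
    refine (Finset.card_le_card ?_).trans (Finset.card_union_le _ _)
    intro v hv
    obtain ⟨hs, u, hu, huv⟩ := hD v hv
    simp only [Finset.mem_union, Finset.mem_filter]
    rcases hU u hu.1 v hs huv with h | h
    · exact Or.inl ⟨hv, h⟩
    · exact Or.inr ⟨hv, h⟩
  unfold weight
  omega

end Sides

/-! ### Fronts that follow the fire, and the growth of the weight -/

section Runs

variable {V : Type*}

/-- From turn `t` to turn `t + 1` the side at `r` with end points `a`, `b` moves outwards if at
least `K` vertices burn on the next parallel side, and stays put otherwise. -/
def Advance (B : ℕ → Set V) (K : ℕ) (p q : V → ℤ) (r a b : ℕ → ℤ) (t : ℕ) : Prop :=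
  (r (t + 1) = r t + 1 ∧ K ≤ (B (t + 1) ∩ side p q (r t + 1) (a t) (b t)).ncard) ∨
    (r (t + 1) = r t ∧ (B (t + 1) ∩ side p q (r t + 1) (a t) (b t)).ncard < K)

/-- The rectangles `[xl t, xr t] × [yl t, yr t]` follow the four fronts of the fire `B`. -/
structure Run (B : ℕ → Set V) (K : ℕ) (x y : V → ℤ) (xl xr yl yr : ℕ → ℤ) : Prop where
  fst_lt : ∀ t, xl t < xr t
  snd_lt : ∀ t, yl t < yr t
  east : ∀ t, Advance B K x y xr yl yr t
  west : ∀ t, Advance B K (-x) y (-xl) yl yr t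
  north : ∀ t, Advance B K y x yr xl xr t
  south : ∀ t, Advance B K (-y) x (-yl) xl xr t
  east_large : ∀ t, K ≤ (B t ∩ side x y (xr t) (yl t) (yr t)).ncard
  west_large : ∀ t, K ≤ (B t ∩ side (-x) y (-xl t) (yl t) (yr t)).ncard
  north_large : ∀ t, K ≤ (B t ∩ side y x (yr t) (xl t) (xr t)).ncard
  south_large : ∀ t, K ≤ (B t ∩ side (-y) x (-yl t) (xl t) (xr t)).ncard

variable {B : ℕ → Set V} {K : ℕ} {x y : V → ℤ} {xl xr yl yr : ℕ → ℤ}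

theorem Run.swap (h : Run B K x y xl xr yl yr) : Run B K y x yl yr xl xr where
  fst_lt := h.snd_lt
  snd_lt := h.fst_lt
  east := h.north
  west := h.south
  north := h.east
  south := h.west
  east_large := h.north_large
  west_large := h.south_large
  north_large := h.east_large
  south_large := h.west_large

theorem Advance.neg_snd {p q : V → ℤ} {r a b : ℕ → ℤ} {t : ℕ} (h : Advance B K p q r a b t) :
    Advance B K p (-q) r (-b) (-a) t := by
  unfold Advance at *
  simpa only [Pi.neg_apply, side_neg_snd] using h

theorem Run.reflect (h : Run B K x y xl xr yl yr) : Run B K (-x) y (-xr) (-xl) yl yr where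
  fst_lt t := neg_lt_neg (h.fst_lt t)
  snd_lt := h.snd_lt
  east := h.west
  west := by simpa only [neg_neg] using h.east
  north t := (h.north t).neg_snd
  south t := (h.south t).neg_snd
  east_large := h.west_large
  west_large := by simpa only [neg_neg, Pi.neg_apply] using h.east_large
  north_large := by simpa only [Pi.neg_apply, side_neg_snd] using h.north_large
  south_large := by simpa only [Pi.neg_apply, side_neg_snd] using h.south_large

theorem Advance.step {p q : V → ℤ} {r a b : ℕ → ℤ} {t : ℕ} (h : Advance B K p q r a b t) :
    r (t + 1) = r t + 1 ∨ r (t + 1) = r t := h.imp And.left And.left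

theorem Run.west_step (h : Run B K x y xl xr yl yr) (t : ℕ) :
    xl (t + 1) = xl t - 1 ∨ xl (t + 1) = xl t := by
  have := (h.west t).step
  simp only [Pi.neg_apply] at this; omega

theorem Run.south_step (h : Run B K x y xl xr yl yr) (t : ℕ) :
    yl (t + 1) = yl t - 1 ∨ yl (t + 1) = yl t := h.swap.west_step t

/-- The fire `B` spreads along the edges of `G` to all vertices outside `F`. -/
structure Spreads (G : SimpleGraph V) (B : ℕ → Set V) (F : ℕ → Finset V) : Prop where
  burning_mono : ∀ t, B t ⊆ B (t + 1)
  protected_mono : ∀ t, F t ⊆ F (t + 1)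
  spread : ∀ t, ∀ u ∈ B t, ∀ v, G.Adj u v → v ∈ B (t + 1) ∨ v ∈ F (t + 1)

variable {G : SimpleGraph V} {F : ℕ → Finset V} {g c : ℕ}

theorem rect_mono {p q : V → ℤ} {pl pr ql qr pl' pr' ql' qr' : ℤ} (h₁ : pl' ≤ pl) (h₂ : pr ≤ pr')
    (h₃ : ql' ≤ ql) (h₄ : qr ≤ qr') : rect p q pl pr ql qr ⊆ rect p q pl' pr' ql' qr' :=
  fun v hv => by simp only [rect, mem_ofPred_eq] at *; omega

theorem side_mono {p q : V → ℤ} {m a b a' b' : ℤ} (h₁ : a' ≤ a) (h₂ : b ≤ b') :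
    side p q m a b ⊆ side p q m a' b' :=
  fun v hv => by simp only [side, mem_ofPred_eq] at *; omega

/-- One side of the rectangle moves from turn `t` to turn `t + 1`, while the other
sides may already have moved. -/
theorem weight_advance {p q : V → ℤ} (hg : SideGrowth G p q g K) (hs : Spreads G B F)
    (hc : SideCount p q g c) {r a b : ℕ → ℤ} {t : ℕ} (h : Advance B K p q r a b t)
    (hl : K ≤ (B t ∩ side p q (r t) (a t) (b t)).ncard) {pl ql qr : ℤ} (hpl : pl ≤ r t)
    (hq : ql < qr) (hqa : ql ≤ a t) (hqb : b t ≤ qr) {M : Set V}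
    (hM : ∀ v ∈ M, v ∈ side p q (r t) ql qr → ql < q v → q v < qr → v ∈ B t)
    (hM' : ∀ v ∈ B (t + 1), v ∈ side p q (r t + 1) ql qr → v ∈ M) :
    (weight M (F (t + 1)) p q pl (r t) ql qr : ℤ) + g * (r (t + 1) - r t) ≤
      weight M (F (t + 1)) p q pl (r (t + 1)) ql qr := by
  rcases h with ⟨h, -⟩ | ⟨h, -⟩
  · have := weight_extend hg (B := B t) (M := M) (F := F (t + 1)) (pl := pl) (pr := r t)
      (ql := ql) (qr := qr) (hc.rect_finite _ _ _ _) hq hpl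
      (fun u hu v hv huv => (hs.spread t u hu v huv).imp (fun h => hM' v h hv) id)
      (hl.trans (ncard_le_ncard (inter_subset_inter_right _ (side_mono hqa hqb))
        ((hc.finite _ _ _).subset inter_subset_right))) hM
    rw [h]
    push_cast [← Int.ofNat_le] at this
    linarith
  · rw [h]; simp

theorem Run.weight_step (h : Run B K x y xl xr yl yr) (hG : Coordinates G x y g K c)
    (hs : Spreads G B F) (t : ℕ) :
    (weight (B t) (F t) x y (xl t) (xr t) (yl t) (yr t) : ℤ) +
      g * ((xr (t + 1) - xl (t + 1) + (yr (t + 1) - yl (t + 1))) -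
        (xr t - xl t + (yr t - yl t))) ≤
    weight (B (t + 1)) (F (t + 1)) x y (xl (t + 1)) (xr (t + 1)) (yl (t + 1)) (yr (t + 1)) := by
  have hx := h.fst_lt t
  have hy := h.snd_lt t
  have e1 := (h.east t).step
  have e2 := h.west_step t
  have e3 := (h.north t).step
  have e4 := h.south_step t
  -- The sides move one at a time. With `M`, new fire counts only outside the old rectangle, so a
  -- side that has yet to move carries only old fire off its ends.
  set M : Set V := B t ∪ (B (t + 1) \ rect x y (xl t) (xr t) (yl t) (yr t)) with hM
  have fin := hG.count_fst.rect_finite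
  have i0 : weight (B t) (F t) x y (xl t) (xr t) (yl t) (yr t) ≤
      weight M (F (t + 1)) x y (xl t) (xr t) (yl t) (yr t) :=
    weight_mono (fin _ _ _ _) (fun v hv => Or.inl hv.1) (hs.protected_mono t)
  have i1 := weight_advance hG.east hs hG.count_fst (h.east t) (h.east_large t)
    (pl := xl t) (ql := yl t) (qr := yr t) (by omega) hy le_rfl le_rfl (M := M)
    (fun v hv hv' h1 h2 => hv.elim id fun hv => absurd
      (by simp only [side, rect, mem_ofPred_eq] at *; omega) hv.2)
    (fun v hv hv' => Or.inr ⟨hv, fun h => by simp only [side, rect, mem_ofPred_eq] at *; omega⟩)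
  have i2 := weight_advance hG.west hs hG.count_fst.neg_fst (h.west t) (h.west_large t)
    (pl := -xr (t + 1)) (ql := yl t) (qr := yr t)
    (by simp only [Pi.neg_apply]; omega) hy le_rfl le_rfl (M := M)
    (fun v hv hv' h1 h2 => hv.elim id fun hv => absurd
      (by simp only [side, rect, mem_ofPred_eq, Pi.neg_apply] at *; omega) hv.2)
    (fun v hv hv' => Or.inr ⟨hv, fun h => by
      simp only [side, rect, mem_ofPred_eq, Pi.neg_apply] at *; omega⟩)
  -- East and west have moved already, so the ends of this side are the new ones; a vertex strictly
  -- between them still lies in the old rectangle.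
  have i3 := weight_advance hG.north hs hG.count_snd (h.north t) (h.north_large t)
    (pl := yl t) (ql := xl (t + 1)) (qr := xr (t + 1))
    (by omega) (by omega) (by omega) (by omega) (M := M)
    (fun v hv hv' h1 h2 => hv.elim id fun hv => absurd
      (by simp only [side, rect, mem_ofPred_eq] at *; omega) hv.2)
    (fun v hv hv' => Or.inr ⟨hv, fun h => by simp only [side, rect, mem_ofPred_eq] at *; omega⟩)
  have i4 := weight_advance hG.south hs hG.count_snd.neg_fst (h.south t) (h.south_large t)
    (pl := -yr (t + 1)) (ql := xl (t + 1)) (qr := xr (t + 1))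
    (by simp only [Pi.neg_apply]; omega) (by omega) (by omega) (by omega) (M := M)
    (fun v hv hv' h1 h2 => hv.elim id fun hv => absurd
      (by simp only [side, rect, mem_ofPred_eq, Pi.neg_apply] at *; omega) hv.2)
    (fun v hv hv' => Or.inr ⟨hv, fun h => by
      simp only [side, rect, mem_ofPred_eq, Pi.neg_apply] at *; omega⟩)
  have i5 : weight M (F (t + 1)) x y (xl (t + 1)) (xr (t + 1)) (yl (t + 1)) (yr (t + 1)) ≤
      weight (B (t + 1)) (F (t + 1)) x y (xl (t + 1)) (xr (t + 1)) (yl (t + 1)) (yr (t + 1)) :=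
    weight_mono (fin _ _ _ _) (fun v hv => hv.1.elim (fun h => hs.burning_mono t h) And.left)
      le_rfl
  simp only [Pi.neg_apply, weight_neg_fst] at i2 i4
  rw [weight_swap _ _ x y, weight_swap _ _ x y] at i3 i4
  have i0' : (weight (B t) (F t) x y (xl t) (xr t) (yl t) (yr t) : ℤ) ≤ _ := Int.ofNat_le.2 i0
  have i5' : (weight M (F (t + 1)) x y (xl (t + 1)) (xr (t + 1)) (yl (t + 1)) (yr (t + 1)) : ℤ) ≤
    _ := Int.ofNat_le.2 i5
  linarith

theorem Run.weight_ge (h : Run B K x y xl xr yl yr) (hG : Coordinates G x y g K c)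
    (hs : Spreads G B F) (t : ℕ) :
    (weight (B 0) (F 0) x y (xl 0) (xr 0) (yl 0) (yr 0) : ℤ) +
      g * ((xr t - xl t + (yr t - yl t)) - (xr 0 - xl 0 + (yr 0 - yl 0))) ≤
    weight (B t) (F t) x y (xl t) (xr t) (yl t) (yr t) := by
  induction t with
  | zero => simp
  | succ t ih =>
    have := h.weight_step hG hs t
    linarith

/-- A front that does not move is almost completely walled off. -/
theorem exists_wall {p q : V → ℤ} (hg : SideGrowth G p q g K) (hs : Spreads G B F)
    (hc : SideCount p q g c) {r a b : ℕ → ℤ} {t : ℕ} (h : Advance B K p q r a b t)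
    (hl : K ≤ (B t ∩ side p q (r t) (a t) (b t)).ncard) (hab : a t < b t)
    (hr : r (t + 1) = r t) :
    ∃ D ⊆ F (t + 1), (∀ v ∈ D, v ∈ side p q (r t + 1) (a t) (b t)) ∧
      (B t ∩ side p q (r t) (a t) (b t) ∩ {v | a t < q v ∧ q v < b t}).ncard ≤ D.card + K := by
  classical
  obtain ⟨D, hD, hcard⟩ := hg (r t) (a t) (b t) _ hab inter_subset_right hl
  refine ⟨D.filter (· ∈ F (t + 1)), fun v hv => (Finset.mem_filter.1 hv).2,
    fun v hv => (hD v (Finset.mem_filter.1 hv).1).1, ?_⟩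
  -- Unprotected vertices of `D` burn at the next turn, and the front stayed put because fewer than
  -- `K` do.
  have h1 : (D.filter (· ∉ F (t + 1))).card < K := by
    rcases h with h | h
    · omega
    · refine lt_of_le_of_lt ?_ h.2
      rw [← ncard_coe_finset]
      refine ncard_le_ncard (fun v hv => ?_) ((hc.finite _ _ _).subset inter_subset_right)
      simp only [Finset.coe_filter, mem_ofPred_eq] at hv
      obtain ⟨hv', u, hu, huv⟩ := hD v hv.1
      exact ⟨(hs.spread t u hu.1 v huv).resolve_right hv.2, hv'⟩
  have h2 := Finset.card_filter_add_card_filter_not (s := D) (· ∈ F (t + 1))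
  omega

/-- What a front loses when it moves is protected. -/
theorem exists_protected {p q : V → ℤ} (hg : SideGrowth G p q g K) (hs : Spreads G B F)
    (hc : SideCount p q g c) {r a b : ℕ → ℤ} {t : ℕ} (h : Advance B K p q r a b t)
    (hl : K ≤ (B t ∩ side p q (r t) (a t) (b t)).ncard) {a' b' : ℤ} (hab : a' < b')
    (ha : a' ≤ a t) (hb : b t ≤ b') (ha' : a (t + 1) ≤ a') (hb' : b' ≤ b (t + 1)) :
    ∃ D ⊆ F (t + 1), (∀ v ∈ D, v ∈ side p q (r t + 1) a' b' ∧ p v ≤ r (t + 1)) ∧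
      ((B t ∩ side p q (r t) (a t) (b t) ∩ {v | a' < q v ∧ q v < b'}).ncard : ℤ) +
        g * (r (t + 1) - r t) ≤
      D.card + (B (t + 1) ∩ side p q (r (t + 1)) (a (t + 1)) (b (t + 1))).ncard := by
  classical
  have hfin := (hc.finite (r (t + 1)) (a (t + 1)) (b (t + 1))).subset
    (inter_subset_right (s := B (t + 1)))
  rcases h with ⟨h, -⟩ | ⟨h, -⟩
  · obtain ⟨D, hD, hcard⟩ := hg (r t) a' b' (B t ∩ side p q (r t) (a t) (b t)) hab
      (inter_subset_right.trans (side_mono ha hb)) hl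
    refine ⟨D.filter (· ∈ F (t + 1)), fun v hv => (Finset.mem_filter.1 hv).2,
      fun v hv => ⟨(hD v (Finset.mem_filter.1 hv).1).1, ?_⟩, ?_⟩
    · have := (hD v (Finset.mem_filter.1 hv).1).1.1
      omega
    · have h1 : (D.filter (· ∉ F (t + 1))).card ≤
          (B (t + 1) ∩ side p q (r (t + 1)) (a (t + 1)) (b (t + 1))).ncard := by
        rw [← ncard_coe_finset]
        refine ncard_le_ncard (fun v hv => ?_) hfin
        simp only [Finset.coe_filter, mem_ofPred_eq] at hv
        obtain ⟨hv', u, hu, huv⟩ := hD v hv.1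
        rw [h]
        exact ⟨(hs.spread t u hu.1 v huv).resolve_right hv.2, side_mono ha' hb' hv'⟩
      have h2 := Finset.card_filter_add_card_filter_not (s := D) (· ∈ F (t + 1))
      have h3 : r (t + 1) - r t = 1 := by omega
      rw [h3]
      push_cast [← Int.ofNat_le] at *
      linarith
  · refine ⟨∅, Finset.empty_subset _, by simp, ?_⟩
    have : (B t ∩ side p q (r t) (a t) (b t) ∩ {v | a' < q v ∧ q v < b'}).ncard ≤
        (B (t + 1) ∩ side p q (r (t + 1)) (a (t + 1)) (b (t + 1))).ncard := by
      refine ncard_le_ncard (fun v hv => ⟨hs.burning_mono t hv.1.1, ?_⟩) hfin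
      rw [h]
      exact side_mono (by omega) (by omega) hv.1.2
    rw [show r (t + 1) - r t = 0 by omega]
    simpa using this

end Runs

/-! ### Protected vertices needed to hold two fronts -/

section Walls

variable {V : Type*} {B : ℕ → Set V} {K : ℕ} {x y : V → ℤ} {xl xr yl yr : ℕ → ℤ}
  {G : SimpleGraph V} {F : ℕ → Finset V} {g c : ℕ}

theorem ncard_inter_side_le {p q : V → ℤ} (hc : SideCount p q g c) (B : Set V) (m a b : ℤ) :
    (B ∩ side p q m a b).ncard ≤
      (B ∩ side p q m a b ∩ {v | a < q v ∧ q v < b}).ncard + c := by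
  have h1 := (hc m a a le_rfl).2.1
  have h2 := (hc m b b le_rfl).2.1
  have f := fun a b => hc.finite m a b
  have : (B ∩ side p q m a b).ncard ≤ (B ∩ side p q m a b ∩ {v | a < q v ∧ q v < b}).ncard +
      ((side p q m a a).ncard + (side p q m b b).ncard) := by
    refine (ncard_le_ncard ?_ (((f a b).subset fun v hv => hv.1.2).union
      ((f a a).union (f b b)))).trans
      ((ncard_union_le _ _).trans (Nat.add_le_add_left (ncard_union_le _ _) _))
    intro v hv
    have := hv.2
    simp only [mem_union, mem_inter_iff, side, mem_ofPred_eq] at *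
    by_cases a < q v ∧ q v < b
    · tauto
    · omega
  simp only [sub_self, mul_zero, zero_add] at h1 h2
  omega

theorem ncard_inter_side_le_length {p q : V → ℤ} (hc : SideCount p q g c) (B : Set V) {m a b : ℤ}
    (hab : a ≤ b) : 2 * ((B ∩ side p q m a b).ncard : ℤ) ≤ g * (b - a) + c := by
  have h1 := (hc m a b hab).2.1
  have h2 := ncard_le_ncard (inter_subset_right (s := B)) (hc.finite m a b)
  omega

theorem ncard_add_card_add_card_le {X S : Set V} {D₁ D₂ : Finset V} (hX : X.Finite) (hS : S ⊆ X)
    (h₁ : (D₁ : Set V) ⊆ X) (h₂ : (D₂ : Set V) ⊆ X) (hS₁ : ∀ v ∈ S, v ∉ D₁) (hS₂ : ∀ v ∈ S, v ∉ D₂)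
    (h₁₂ : ∀ v ∈ D₁, v ∉ D₂) : S.ncard + D₁.card + D₂.card ≤ X.ncard := by
  classical
  rw [add_assoc, ← Finset.card_union_of_disjoint (Finset.disjoint_left.2 fun v => h₁₂ v),
    ← ncard_coe_finset, ← ncard_union_eq ?_ (hX.subset hS) (Finset.finite_toSet _)]
  · refine ncard_le_ncard (union_subset hS ?_) hX
    rw [Finset.coe_union]; exact union_subset h₁ h₂
  · rw [Set.disjoint_left]
    intro v hv hv'
    rw [Finset.mem_coe, Finset.mem_union] at hv'
    exact hv'.elim (hS₁ v hv) (hS₂ v hv)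

/-- Cost of holding two adjacent fronts. -/
theorem Run.card_of_adjacent (h : Run B K x y xl xr yl yr) (hG : Coordinates G x y g K c)
    (hs : Spreads G B F) {t : ℕ} (hE : xr (t + 1) = xr t) (hN : yr (t + 1) = yr t) :
    2 * (weight (B t) (F t) x y (xl t) (xr t) (yl t) (yr t) : ℤ) ≤
      2 * (F (t + 1)).card + g * (xr t - xl t + (yr t - yl t)) + 3 * c + 4 * K := by
  obtain ⟨D₁, hF₁, hD₁, c₁⟩ := exists_wall hG.east hs hG.count_fst (h.east t) (h.east_large t)
    (h.snd_lt t) hE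
  obtain ⟨D₂, hF₂, hD₂, c₂⟩ := exists_wall hG.north hs hG.count_snd (h.north t) (h.north_large t)
    (h.fst_lt t) hN
  have hcard := ncard_add_card_add_card_le (X := F (t + 1))
    (S := (F t : Set V) ∩ rect x y (xl t) (xr t) (yl t) (yr t)) (D₁ := D₁) (D₂ := D₂)
    (Finset.finite_toSet _) (fun v hv => hs.protected_mono t hv.1) hF₁ hF₂
    (fun v hv hv' => by
      have h1 := hD₁ v hv'; have h2 := hv.2
      simp only [side, rect, mem_ofPred_eq] at h1 h2; omega)
    (fun v hv hv' => by
      have h1 := hD₂ v hv'; have h2 := hv.2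
      simp only [side, rect, mem_ofPred_eq] at h1 h2; omega)
    (fun v hv hv' => by
      have h1 := hD₁ v hv; have h2 := hD₂ v hv'
      simp only [side, mem_ofPred_eq] at h1 h2; omega)
  rw [ncard_coe_finset] at hcard
  have w := ncard_inter_side_le_length hG.count_fst (B t) (m := xl t) (h.snd_lt t).le
  have s := ncard_inter_side_le_length hG.count_snd (B t) (m := yl t) (h.fst_lt t).le
  have k := ncard_inter_side_le_length hG.count_fst (B t) (m := xr t) (le_refl (yr t))
  have fx := fun m => hG.count_fst.finite m
  have fy := fun m => hG.count_snd.finite m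
  set A₁ := B t ∩ side x y (xr t) (yl t) (yr t) ∩ {v | yl t < y v ∧ y v < yr t}
  set A₂ := B t ∩ side y x (yr t) (xl t) (xr t) ∩ {v | xl t < x v ∧ x v < xr t}
  -- The interiors of the held fronts are matched with `D₁` and `D₂`, and the other two sides are
  -- bounded by their lengths. The common corner of the held fronts is in neither interior and is
  -- counted apart.
  have hfr : (B t ∩ frame x y (xl t) (xr t) (yl t) (yr t)).ncard ≤ A₁.ncard + (A₂.ncard +
      ((B t ∩ side x y (xl t) (yl t) (yr t)).ncard + ((B t ∩ side y x (yl t) (xl t) (xr t)).ncard +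
        (B t ∩ side x y (xr t) (yr t) (yr t)).ncard))) := by
    refine (ncard_le_ncard (t := A₁ ∪ (A₂ ∪ (B t ∩ side x y (xl t) (yl t) (yr t) ∪
      (B t ∩ side y x (yl t) (xl t) (xr t) ∪ B t ∩ side x y (xr t) (yr t) (yr t))))) ?_ ?_).trans
      ((ncard_union_le _ _).trans (Nat.add_le_add_left ((ncard_union_le _ _).trans
      (Nat.add_le_add_left ((ncard_union_le _ _).trans
      (Nat.add_le_add_left (ncard_union_le _ _) _)) _)) _))
    · intro v hv
      have hb := hv.1
      have hf := hv.2
      simp only [A₁, A₂, frame, rect, side, mem_union, mem_inter_iff, mem_ofPred_eq] at hf ⊢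
      simp only [hb, true_and]
      omega
    · exact ((fx _ _ _).subset fun v hv => hv.1.2).union (((fy _ _ _).subset fun v hv =>
        hv.1.2).union (((fx _ _ _).subset inter_subset_right).union
          (((fy _ _ _).subset inter_subset_right).union ((fx _ _ _).subset inter_subset_right))))
  simp only [sub_self, mul_zero, zero_add] at k
  unfold weight
  push_cast [← Int.ofNat_le] at *
  linarith

/-- Cost of holding two opposite fronts. -/
theorem Run.card_of_opposite (h : Run B K x y xl xr yl yr) (hG : Coordinates G x y g K c)
    (hs : Spreads G B F) {t : ℕ} (hE : xr (t + 1) = xr t) (hW : xl (t + 1) = xl t) :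
    2 * (weight (B t) (F t) x y (xl t) (xr t) (yl t) (yr t) : ℤ) ≤
      2 * (F (t + 1)).card + 2 * (g * (xr t - xl t)) + 2 * c + 4 * K := by
  obtain ⟨D₁, hF₁, hD₁, c₁⟩ := exists_wall hG.east hs hG.count_fst (h.east t) (h.east_large t)
    (h.snd_lt t) hE
  obtain ⟨D₂, hF₂, hD₂, c₂⟩ := exists_wall hG.west hs hG.count_fst.neg_fst (h.west t)
    (h.west_large t) (h.snd_lt t) (by simp only [Pi.neg_apply, hW])
  simp only [Pi.neg_apply, side_neg_fst] at c₂
  have hx := h.fst_lt t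
  have hcard := ncard_add_card_add_card_le (X := F (t + 1))
    (S := (F t : Set V) ∩ rect x y (xl t) (xr t) (yl t) (yr t)) (D₁ := D₁) (D₂ := D₂)
    (Finset.finite_toSet _) (fun v hv => hs.protected_mono t hv.1) hF₁ hF₂
    (fun v hv hv' => by
      have h1 := hD₁ v hv'; have h2 := hv.2
      simp only [side, rect, mem_ofPred_eq] at h1 h2; omega)
    (fun v hv hv' => by
      have h1 := hD₂ v hv'; have h2 := hv.2
      simp only [side, rect, mem_ofPred_eq, Pi.neg_apply] at h1 h2; omega)
    (fun v hv hv' => by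
      have h1 := hD₁ v hv; have h2 := hD₂ v hv'
      simp only [side, mem_ofPred_eq, Pi.neg_apply] at h1 h2; omega)
  rw [ncard_coe_finset] at hcard
  have n := ncard_inter_side_le_length hG.count_snd (B t) (m := yr t) (h.fst_lt t).le
  have s := ncard_inter_side_le_length hG.count_snd (B t) (m := yl t) (h.fst_lt t).le
  have fx := fun m => hG.count_fst.finite m
  have fy := fun m => hG.count_snd.finite m
  set A₁ := B t ∩ side x y (xr t) (yl t) (yr t) ∩ {v | yl t < y v ∧ y v < yr t}
  set A₂ := B t ∩ side x y (xl t) (yl t) (yr t) ∩ {v | yl t < y v ∧ y v < yr t}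
  have hfr : (B t ∩ frame x y (xl t) (xr t) (yl t) (yr t)).ncard ≤ A₁.ncard + (A₂.ncard +
      ((B t ∩ side y x (yr t) (xl t) (xr t)).ncard +
        (B t ∩ side y x (yl t) (xl t) (xr t)).ncard)) := by
    refine (ncard_le_ncard (t := A₁ ∪ (A₂ ∪ (B t ∩ side y x (yr t) (xl t) (xr t) ∪
      B t ∩ side y x (yl t) (xl t) (xr t)))) ?_ ?_).trans
      ((ncard_union_le _ _).trans (Nat.add_le_add_left ((ncard_union_le _ _).trans
      (Nat.add_le_add_left (ncard_union_le _ _) _)) _))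
    · intro v hv
      have hb := hv.1
      have hf := hv.2
      simp only [A₁, A₂, frame, rect, side, mem_union, mem_inter_iff, mem_ofPred_eq] at hf ⊢
      simp only [hb, true_and]
      omega
    · exact ((fx _ _ _).subset fun v hv => hv.1.2).union (((fx _ _ _).subset fun v hv =>
        hv.1.2).union (((fy _ _ _).subset inter_subset_right).union
          ((fy _ _ _).subset inter_subset_right)))
  unfold weight
  push_cast [← Int.ofNat_le] at *
  linarith

/-- The protected vertices between the lines through the east and west fronts, up to one step
beyond the north and south fronts, plus the burning vertices on the east and west fronts. -/
noncomputable def stripWeight (B : Set V) (F : Finset V) (x y : V → ℤ) (xl xr yl yr : ℤ) : ℕ :=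
  ((F : Set V) ∩ rect x y xl xr (yl - 1) (yr + 1)).ncard +
    (B ∩ side x y xr yl yr).ncard + (B ∩ side x y xl yl yr).ncard

/-- Starts the strip at a turn when the north front holds: the wall facing it lies one step beyond,
hence in the strip, and makes up for the burning north side. Up to a constant only the south side is
lost, about g/2 times the width, while each move of east or west gains g. -/
theorem Run.le_stripWeight (h : Run B K x y xl xr yl yr) (hG : Coordinates G x y g K c)
    (hs : Spreads G B F) {t : ℕ} (hN : yr (t + 1) = yr t) :
    2 * (weight (B t) (F t) x y (xl t) (xr t) (yl t) (yr t) : ℤ) +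
      2 * (g * ((xr (t + 1) - xl (t + 1)) - (xr t - xl t))) ≤
    2 * stripWeight (B (t + 1)) (F (t + 1)) x y (xl (t + 1)) (xr (t + 1)) (yl (t + 1)) (yr (t + 1))
      + g * (xr t - xl t) + 5 * c + 2 * K := by
  classical
  have hx := h.fst_lt t
  have hy := h.snd_lt t
  have e1 := (h.east t).step
  have e2 := h.west_step t
  have e3 := h.south_step t
  obtain ⟨D₁, hF₁, hD₁, c₁⟩ := exists_protected hG.east hs hG.count_fst (h.east t) (h.east_large t)
    (h.snd_lt t) le_rfl le_rfl (by omega) hN.ge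
  obtain ⟨D₂, hF₂, hD₂, c₂⟩ := exists_protected hG.west hs hG.count_fst.neg_fst (h.west t)
    (h.west_large t) (h.snd_lt t) le_rfl le_rfl (by omega) hN.ge
  obtain ⟨D₃, hF₃, hD₃, c₃⟩ := exists_wall hG.north hs hG.count_snd (h.north t) (h.north_large t)
    (h.fst_lt t) hN
  simp only [Pi.neg_apply, side_neg_fst] at c₂
  have m₁ := ncard_inter_side_le hG.count_fst (B t) (xr t) (yl t) (yr t)
  have m₂ := ncard_inter_side_le hG.count_fst (B t) (xl t) (yl t) (yr t)
  have s := ncard_inter_side_le_length hG.count_snd (B t) (m := yl t) (h.fst_lt t).le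
  have fx := fun m => hG.count_fst.finite m
  have fy := fun m => hG.count_snd.finite m
  have fr := hG.count_fst.rect_finite
  set R : Set V := (F (t + 1) : Set V) ∩
    rect x y (xl (t + 1)) (xr (t + 1)) (yl (t + 1) - 1) (yr (t + 1) + 1) with hR
  set S : Set V := ((F t : Set V) ∩ rect x y (xl t) (xr t) (yl t) (yr t)) ∪ D₃ with hS
  have hScard : S.ncard = ((F t : Set V) ∩ rect x y (xl t) (xr t) (yl t) (yr t)).ncard +
      D₃.card := by
    rw [hS, ncard_union_eq ?_ ((fr _ _ _ _).subset inter_subset_right) (Finset.finite_toSet _),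
      ncard_coe_finset]
    rw [Set.disjoint_left]
    intro v hv hv'
    have h1 := hv.2
    have h2 := hD₃ v hv'
    simp only [side, rect, mem_ofPred_eq] at h1 h2; omega
  have hcard := ncard_add_card_add_card_le (X := R) (S := S) (D₁ := D₁) (D₂ := D₂)
    ((fr _ _ _ _).subset inter_subset_right)
    (fun v hv => by
      rcases hv with hv | hv
      · exact ⟨hs.protected_mono t hv.1,
          rect_mono (by omega) (by omega) (by omega) (by omega) hv.2⟩
      · refine ⟨hF₃ hv, ?_⟩
        have := hD₃ v hv
        simp only [side, rect, mem_ofPred_eq] at this ⊢; omega)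
    (fun v hv => by
      refine ⟨hF₁ hv, ?_⟩
      have := hD₁ v hv
      simp only [side, rect, mem_ofPred_eq] at this ⊢; omega)
    (fun v hv => by
      refine ⟨hF₂ hv, ?_⟩
      have := hD₂ v hv
      simp only [side, rect, mem_ofPred_eq, Pi.neg_apply] at this ⊢; omega)
    (fun v hv hv' => by
      have h1 := hD₁ v hv'
      rcases hv with hv | hv
      · have h2 := hv.2
        simp only [side, rect, mem_ofPred_eq] at h1 h2; omega
      · have h2 := hD₃ v hv
        simp only [side, mem_ofPred_eq] at h1 h2; omega)
    (fun v hv hv' => by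
      have h1 := hD₂ v hv'
      rcases hv with hv | hv
      · have h2 := hv.2
        simp only [side, rect, mem_ofPred_eq, Pi.neg_apply] at h1 h2; omega
      · have h2 := hD₃ v hv
        simp only [side, mem_ofPred_eq, Pi.neg_apply] at h1 h2; omega)
    (fun v hv hv' => by
      have h1 := hD₁ v hv; have h2 := hD₂ v hv'
      simp only [side, mem_ofPred_eq, Pi.neg_apply] at h1 h2; omega)
  set A₁ := B t ∩ side x y (xr t) (yl t) (yr t)
  set A₂ := B t ∩ side x y (xl t) (yl t) (yr t)
  set A₃ := B t ∩ side y x (yr t) (xl t) (xr t) ∩ {v | xl t < x v ∧ x v < xr t}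
  have hfr : (B t ∩ frame x y (xl t) (xr t) (yl t) (yr t)).ncard ≤ A₁.ncard + (A₂.ncard +
      (A₃.ncard + (B t ∩ side y x (yl t) (xl t) (xr t)).ncard)) := by
    refine (ncard_le_ncard (t := A₁ ∪ (A₂ ∪ (A₃ ∪
      B t ∩ side y x (yl t) (xl t) (xr t)))) ?_ ?_).trans
      ((ncard_union_le _ _).trans (Nat.add_le_add_left ((ncard_union_le _ _).trans
      (Nat.add_le_add_left (ncard_union_le _ _) _)) _))
    · intro v hv
      have hb := hv.1
      have hf := hv.2
      simp only [A₁, A₂, A₃, frame, rect, side, mem_union, mem_inter_iff, mem_ofPred_eq] at hf ⊢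
      simp only [hb, true_and]
      omega
    · exact ((fx _ _ _).subset inter_subset_right).union (((fx _ _ _).subset
        inter_subset_right).union (((fy _ _ _).subset fun v hv => hv.1.2).union
          ((fy _ _ _).subset inter_subset_right)))
  unfold weight stripWeight
  push_cast [← Int.ofNat_le, hScard] at *
  linarith

/-- When north and south both move, the east and west sides lengthen at both ends. Every old burning
vertex is then interior to the longer side, so no constant is lost and errors do not accumulate over
the turns. -/
theorem Run.stripWeight_step (h : Run B K x y xl xr yl yr) (hG : Coordinates G x y g K c)
    (hs : Spreads G B F) {t : ℕ} (hN : yr (t + 1) = yr t + 1) (hS : yl (t + 1) = yl t - 1) :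
    (stripWeight (B t) (F t) x y (xl t) (xr t) (yl t) (yr t) : ℤ) +
      g * ((xr (t + 1) - xl (t + 1)) - (xr t - xl t)) ≤
    stripWeight (B (t + 1)) (F (t + 1)) x y (xl (t + 1)) (xr (t + 1)) (yl (t + 1)) (yr (t + 1)) := by
  have hx := h.fst_lt t
  have hy := h.snd_lt t
  have e1 := (h.east t).step
  have e2 := h.west_step t
  obtain ⟨D₁, hF₁, hD₁, c₁⟩ := exists_protected hG.east hs hG.count_fst (h.east t) (h.east_large t)
    (a' := yl t - 1) (b' := yr t + 1) (by omega) (by omega) (by omega) hS.le hN.ge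
  obtain ⟨D₂, hF₂, hD₂, c₂⟩ := exists_protected hG.west hs hG.count_fst.neg_fst (h.west t)
    (h.west_large t) (a' := yl t - 1) (b' := yr t + 1) (by omega) (by omega) (by omega) hS.le hN.ge
  simp only [Pi.neg_apply, side_neg_fst] at c₂
  have hall : ∀ m, B t ∩ side x y m (yl t) (yr t) ∩ {v | yl t - 1 < y v ∧ y v < yr t + 1} =
      B t ∩ side x y m (yl t) (yr t) := fun m => by
    refine inter_eq_left.2 fun v hv => ?_
    have := hv.2
    simp only [side, mem_ofPred_eq] at this ⊢; omega
  rw [hall] at c₁ c₂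
  have hcard := ncard_add_card_add_card_le
    (X := (F (t + 1) : Set V) ∩
      rect x y (xl (t + 1)) (xr (t + 1)) (yl (t + 1) - 1) (yr (t + 1) + 1))
    (S := (F t : Set V) ∩ rect x y (xl t) (xr t) (yl t - 1) (yr t + 1)) (D₁ := D₁) (D₂ := D₂)
    ((hG.count_fst.rect_finite _ _ _ _).subset inter_subset_right)
    (fun v hv => ⟨hs.protected_mono t hv.1,
      rect_mono (by omega) (by omega) (by omega) (by omega) hv.2⟩)
    (fun v hv => by
      refine ⟨hF₁ hv, ?_⟩
      have := hD₁ v hv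
      simp only [side, rect, mem_ofPred_eq] at this ⊢; omega)
    (fun v hv => by
      refine ⟨hF₂ hv, ?_⟩
      have := hD₂ v hv
      simp only [side, rect, mem_ofPred_eq, Pi.neg_apply] at this ⊢; omega)
    (fun v hv hv' => by
      have h1 := hD₁ v hv'
      have h2 := hv.2
      simp only [side, rect, mem_ofPred_eq] at h1 h2; omega)
    (fun v hv hv' => by
      have h1 := hD₂ v hv'
      have h2 := hv.2
      simp only [side, rect, mem_ofPred_eq, Pi.neg_apply] at h1 h2; omega)
    (fun v hv hv' => by
      have h1 := hD₁ v hv; have h2 := hD₂ v hv'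
      simp only [side, mem_ofPred_eq, Pi.neg_apply] at h1 h2; omega)
  unfold stripWeight
  push_cast [← Int.ofNat_le] at *
  linarith

/-- The walls facing the two held fronts lie outside the strip, so they add to the protected
vertices inside it. -/
theorem Run.stripWeight_le_card (h : Run B K x y xl xr yl yr) (hG : Coordinates G x y g K c)
    (hs : Spreads G B F) {t : ℕ} (hE : xr (t + 1) = xr t) (hW : xl (t + 1) = xl t) :
    stripWeight (B t) (F t) x y (xl t) (xr t) (yl t) (yr t) ≤
      (F (t + 1)).card + 2 * c + 2 * K := by
  have hx := h.fst_lt t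
  obtain ⟨D₁, hF₁, hD₁, c₁⟩ := exists_wall hG.east hs hG.count_fst (h.east t) (h.east_large t)
    (h.snd_lt t) hE
  obtain ⟨D₂, hF₂, hD₂, c₂⟩ := exists_wall hG.west hs hG.count_fst.neg_fst (h.west t)
    (h.west_large t) (h.snd_lt t) (by simp only [Pi.neg_apply, hW])
  simp only [Pi.neg_apply, side_neg_fst] at c₂
  have m₁ := ncard_inter_side_le hG.count_fst (B t) (xr t) (yl t) (yr t)
  have m₂ := ncard_inter_side_le hG.count_fst (B t) (xl t) (yl t) (yr t)
  have hcard := ncard_add_card_add_card_le (X := F (t + 1))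
    (S := (F t : Set V) ∩ rect x y (xl t) (xr t) (yl t - 1) (yr t + 1)) (D₁ := D₁) (D₂ := D₂)
    (Finset.finite_toSet _) (fun v hv => hs.protected_mono t hv.1) hF₁ hF₂
    (fun v hv hv' => by
      have h1 := hD₁ v hv'; have h2 := hv.2
      simp only [side, rect, mem_ofPred_eq] at h1 h2; omega)
    (fun v hv hv' => by
      have h1 := hD₂ v hv'; have h2 := hv.2
      simp only [side, rect, mem_ofPred_eq, Pi.neg_apply] at h1 h2; omega)
    (fun v hv hv' => by
      have h1 := hD₁ v hv; have h2 := hD₂ v hv'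
      simp only [side, mem_ofPred_eq, Pi.neg_apply] at h1 h2; omega)
  rw [ncard_coe_finset] at hcard
  unfold stripWeight
  omega

end Walls

/-! ### A large burning square escapes at rate 3g/2 -/

section LowerBound

variable {V : Type*} {B : ℕ → Set V} {K : ℕ} {x y : V → ℤ} {xl xr yl yr : ℕ → ℤ}
  {G : SimpleGraph V} {F : ℕ → Finset V} {g c N : ℕ}

/-- A run that starts with a large burning square against a player with budget `3 * g / 2 * t`. -/
structure LargeRun (G : SimpleGraph V) (B : ℕ → Set V) (F : ℕ → Finset V) (g K c N : ℕ)
    (x y : V → ℤ) (xl xr yl yr : ℕ → ℤ) : Prop where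
  run : Run B K x y xl xr yl yr
  coords : Coordinates G x y g K c
  spreads : Spreads G B F
  fst_zero : xr 0 - xl 0 = 2 * N
  snd_zero : yr 0 - yl 0 = 2 * N
  weight_zero : 8 * (g * N : ℤ) - 4 * g ≤ 2 * weight (B 0) (F 0) x y (xl 0) (xr 0) (yl 0) (yr 0)
  budget : ∀ t : ℕ, 2 * ((F (t + 1)).card : ℤ) ≤ 3 * (g * (t + 1))
  large : 20 * (g + c + K : ℤ) < 4 * (g * N)

theorem LargeRun.swap (h : LargeRun G B F g K c N x y xl xr yl yr) :
    LargeRun G B F g K c N y x yl yr xl xr where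
  run := h.run.swap
  coords := h.coords.swap
  spreads := h.spreads
  fst_zero := h.snd_zero
  snd_zero := h.fst_zero
  weight_zero := by rw [weight_swap]; exact h.weight_zero
  budget := h.budget
  large := h.large

theorem LargeRun.reflect (h : LargeRun G B F g K c N x y xl xr yl yr) :
    LargeRun G B F g K c N (-x) y (-xr) (-xl) yl yr where
  run := h.run.reflect
  coords := h.coords.reflect
  spreads := h.spreads
  fst_zero := by have := h.fst_zero; simp only [Pi.neg_apply]; omega
  snd_zero := h.snd_zero
  weight_zero := by simp only [Pi.neg_apply, weight_neg_fst]; exact h.weight_zero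
  budget := h.budget
  large := h.large

/-- If at most one side rests per turn, then at least one of north and south moves; hence the bound
on the height. -/
theorem LargeRun.perimeter_ge (h : LargeRun G B F g K c N x y xl xr yl yr) {T : ℕ}
    (hfast : ∀ t < T, xr t - xl t + (yr t - yl t) + 3 ≤
      xr (t + 1) - xl (t + 1) + (yr (t + 1) - yl (t + 1))) :
    ∀ t ≤ T, 4 * (N : ℤ) + 3 * t ≤ xr t - xl t + (yr t - yl t) ∧
      2 * (N : ℤ) + t ≤ yr t - yl t := by
  intro t
  induction t with
  | zero => intro; have := h.fst_zero; have := h.snd_zero; push_cast; omega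
  | succ t ih =>
    intro ht
    have h1 := ih (by omega)
    have h2 := hfast t (by omega)
    have e1 := (h.run.east t).step
    have e2 := h.run.west_step t
    have e3 := (h.run.north t).step
    have e4 := h.run.south_step t
    push_cast
    omega

theorem LargeRun.weight_ge (h : LargeRun G B F g K c N x y xl xr yl yr) (t : ℕ) :
    2 * (g * (xr t - xl t + (yr t - yl t))) - 4 * (g : ℤ) ≤
      2 * weight (B t) (F t) x y (xl t) (xr t) (yl t) (yr t) := by
  have h1 := h.run.weight_ge h.coords h.spreads t
  rw [h.fst_zero, h.snd_zero] at h1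
  have h2 := h.weight_zero
  linarith

/-- The weight is about g(w + ℓ), of which the two free sides carry at most half. So about g(4N +
3T)/2 vertices must be protected, and the term in N beats all constants. -/
theorem LargeRun.not_adjacent (h : LargeRun G B F g K c N x y xl xr yl yr) {T : ℕ}
    (hfast : ∀ t < T, xr t - xl t + (yr t - yl t) + 3 ≤
      xr (t + 1) - xl (t + 1) + (yr (t + 1) - yl (t + 1)))
    (hE : xr (T + 1) = xr T) (hN : yr (T + 1) = yr T) : False := by
  have h1 := h.run.card_of_adjacent h.coords h.spreads hE hN
  have h2 := h.weight_ge T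
  have h3 := h.budget T
  have h4 := mul_le_mul_of_nonneg_left (h.perimeter_ge hfast T le_rfl).1 (Int.natCast_nonneg g)
  have h5 := h.large
  have := Int.natCast_nonneg g
  have := Int.natCast_nonneg c
  have := Int.natCast_nonneg K
  linarith

/-- With widths w and heights ℓ, the strip started at turn s requires g(ℓ_s + w_T - w_s/2) protected
vertices, and holding east and west at T requires gℓ_T, both up to constants. North rests at s and
the other sides move; afterwards north and south both move, and so does east or west. The two bounds
then add up to at least g(5N + 3T), while twice the budget is 3g(T + 1). -/
theorem LargeRun.not_opposite_of_north (h : LargeRun G B F g K c N x y xl xr yl yr) {T s : ℕ}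
    (hfast : ∀ t < T, xr t - xl t + (yr t - yl t) + 3 ≤
      xr (t + 1) - xl (t + 1) + (yr (t + 1) - yl (t + 1)))
    (hs : s < T) (hN : yr (s + 1) = yr s)
    (hlast : ∀ t, s < t → t < T → yr (t + 1) - yl (t + 1) = yr t - yl t + 2)
    (hE : xr (T + 1) = xr T) (hW : xl (T + 1) = xl T) : False := by
  have key : ∀ t, s + 1 ≤ t → t ≤ T →
      (stripWeight (B (s + 1)) (F (s + 1)) x y (xl (s + 1)) (xr (s + 1)) (yl (s + 1)) (yr (s + 1))
        : ℤ) + g * ((xr t - xl t) - (xr (s + 1) - xl (s + 1))) ≤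
        stripWeight (B t) (F t) x y (xl t) (xr t) (yl t) (yr t) ∧
      yr (s + 1) - yl (s + 1) + 2 * ((t : ℤ) - s - 1) = yr t - yl t ∧
      xr (s + 1) - xl (s + 1) + ((t : ℤ) - s - 1) ≤ xr t - xl t := by
    intro t hst
    induction t, hst using Nat.le_induction with
    | base => intro; push_cast; simp
    | succ t hst ih =>
      intro htT
      obtain ⟨i1, i2, i3⟩ := ih (by omega)
      have l := hlast t (by omega) (by omega)
      have f := hfast t (by omega)
      have e3 := (h.run.north t).step
      have e4 := h.run.south_step t
      have st := h.run.stripWeight_step h.coords h.spreads (t := t) (by omega) (by omega)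
      push_cast
      refine ⟨by linarith, by omega, by omega⟩
  obtain ⟨k1, k2, k3⟩ := key T hs le_rfl
  have a1 := h.run.le_stripWeight h.coords h.spreads hN
  have a2 : (_ : ℤ) ≤ _ :=
    Int.ofNat_le.2 (h.run.stripWeight_le_card h.coords h.spreads hE hW)
  push_cast at a2
  have a3 := h.run.card_of_opposite h.coords h.spreads hE hW
  have w1 := h.weight_ge s
  have w2 := h.weight_ge T
  have b := h.budget T
  have f := hfast s hs
  have e1 := (h.run.east s).step
  have e2 := h.run.west_step s
  have e4 := h.run.south_step s
  obtain ⟨p1, p2⟩ := h.perimeter_ge hfast s hs.le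
  have hg := Int.natCast_nonneg g
  have q1 : yr T - yl T = yr s - yl s + 2 * ((T : ℤ) - s) - 1 := by omega
  have q2 : xr s - xl s + ((T : ℤ) - s + 1) ≤ xr T - xl T := by omega
  -- By `q1` and `q2` the right side is at least 4ℓ_s + w_s + 6(T - s), and 4ℓ_s + w_s = (w_s + ℓ_s)
  -- + 3ℓ_s ≥ (4N + 3s) + 3(2N + s).
  have r : 10 * (N : ℤ) + 6 * T ≤ 2 * (yr T - yl T) + 2 * (yr s - yl s) + (xr s - xl s) +
      2 * ((xr T - xl T) - (xr s - xl s)) := by omega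
  have r' := mul_le_mul_of_nonneg_left r hg
  have l := h.large
  have := Int.natCast_nonneg c
  have := Int.natCast_nonneg K
  linarith

/-- If north and south moved at every turn before T, the height 2N + 2T alone makes the walls too
expensive. Otherwise take the last turn s at which one of them rested, reflecting south to north if
necessary. -/
theorem LargeRun.not_opposite (h : LargeRun G B F g K c N x y xl xr yl yr) {T : ℕ}
    (hfast : ∀ t < T, xr t - xl t + (yr t - yl t) + 3 ≤
      xr (t + 1) - xl (t + 1) + (yr (t + 1) - yl (t + 1)))
    (hE : xr (T + 1) = xr T) (hW : xl (T + 1) = xl T) : False := by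
  have dich : ∀ n ≤ T, (∀ t < n, yr (t + 1) - yl (t + 1) = yr t - yl t + 2) ∨
      ∃ s < n, yr (s + 1) - yl (s + 1) ≠ yr s - yl s + 2 ∧
        ∀ t, s < t → t < n → yr (t + 1) - yl (t + 1) = yr t - yl t + 2 := by
    intro n
    induction n with
    | zero => intro; left; intro t ht; omega
    | succ n ih =>
      intro hn
      by_cases hc : yr (n + 1) - yl (n + 1) = yr n - yl n + 2
      · rcases ih (by omega) with i | ⟨s, hs, hs', i⟩
        · left
          intro t ht
          rcases Nat.lt_succ_iff_lt_or_eq.1 ht with ht | rfl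
          exacts [i t ht, hc]
        · right
          refine ⟨s, by omega, hs', fun t ht ht' => ?_⟩
          rcases Nat.lt_succ_iff_lt_or_eq.1 ht' with ht' | rfl
          exacts [i t ht ht', hc]
      · right
        exact ⟨n, by omega, hc, fun t ht ht' => by omega⟩
  rcases dich T le_rfl with hT | ⟨s, hs, hs', hlast⟩
  · have k : ∀ t ≤ T, yr t - yl t = 2 * (N : ℤ) + 2 * t := by
      intro t
      induction t with
      | zero => intro; have := h.snd_zero; push_cast; omega
      | succ t ih =>
        intro ht
        have := ih (by omega)
        have := hT t (by omega)
        push_cast; omega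
    have kT := k T le_rfl
    have a3 := h.run.card_of_opposite h.coords h.spreads hE hW
    have w2 := h.weight_ge T
    have b := h.budget T
    have l := h.large
    have := Int.natCast_nonneg g
    have := Int.natCast_nonneg c
    have := Int.natCast_nonneg K
    have : (0 : ℤ) ≤ g * T := by positivity
    rw [kT] at w2
    linarith
  · have e3 := (h.run.north s).step
    have e4 := h.run.south_step s
    rcases e3 with e3 | e3
    · refine h.swap.reflect.swap.not_opposite_of_north ?_ hs ?_ ?_ hE hW
      · intro t ht
        have := hfast t ht
        simp only [Pi.neg_apply]; omega
      · simp only [Pi.neg_apply]; omega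
      · intro t ht ht'
        have := hlast t ht ht'
        simp only [Pi.neg_apply]; omega
    · exact h.not_opposite_of_north hfast hs e3 hlast hE hW

/-- At a first turn with fewer than three moves some two sides rest; each of the six pairs is, up to
symmetry, an opposite or an adjacent one. -/
theorem LargeRun.fast (h : LargeRun G B F g K c N x y xl xr yl yr) (T : ℕ) :
    xr T - xl T + (yr T - yl T) + 3 ≤
      xr (T + 1) - xl (T + 1) + (yr (T + 1) - yl (T + 1)) := by
  induction T using Nat.strong_induction_on with
  | _ T ih =>
  by_contra hT
  have e1 := (h.run.east T).step
  have e2 := h.run.west_step T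
  have e3 := (h.run.north T).step
  have e4 := h.run.south_step T
  have cases : (xr (T + 1) = xr T ∧ xl (T + 1) = xl T) ∨ (yr (T + 1) = yr T ∧ yl (T + 1) = yl T) ∨
      (xr (T + 1) = xr T ∧ yr (T + 1) = yr T) ∨ (xl (T + 1) = xl T ∧ yr (T + 1) = yr T) ∨
      (xr (T + 1) = xr T ∧ yl (T + 1) = yl T) ∨ (xl (T + 1) = xl T ∧ yl (T + 1) = yl T) := by
    omega
  have ih' : ∀ t < T, yr t - yl t + (xr t - xl t) + 3 ≤
      yr (t + 1) - yl (t + 1) + (xr (t + 1) - xl (t + 1)) := fun t ht => by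
    have := ih t ht; omega
  rcases cases with ⟨a, b⟩ | ⟨a, b⟩ | ⟨a, b⟩ | ⟨a, b⟩ | ⟨a, b⟩ | ⟨a, b⟩
  · exact h.not_opposite ih a b
  · exact h.swap.not_opposite ih' a b
  · exact h.not_adjacent ih a b
  · refine h.reflect.not_adjacent (T := T) (fun t ht => ?_) ?_ b
    · have := ih t ht
      simp only [Pi.neg_apply]; omega
    · simp only [Pi.neg_apply]; omega
  · refine h.swap.reflect.not_adjacent (T := T) (fun t ht => ?_) ?_ a
    · have := ih t ht
      simp only [Pi.neg_apply]; omega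
    · simp only [Pi.neg_apply]; omega
  · refine h.reflect.swap.reflect.not_adjacent (T := T) (fun t ht => ?_) ?_ ?_
    · have := ih t ht
      simp only [Pi.neg_apply]; omega
    all_goals simp only [Pi.neg_apply]; omega

/-- The extents `(xl, xr, yl, yr)` of the rectangle that follows the fronts of the fire `B`. -/
noncomputable def extents (B : ℕ → Set V) (K : ℕ) (x y : V → ℤ) (N : ℕ) :
    ℕ → ℤ × ℤ × ℤ × ℤ
  | 0 => (-N, N, -N, N)
  | t + 1 =>
    let e := extents B K x y N t
    let move (p q : V → ℤ) (r a b : ℤ) : ℤ :=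
      open Classical in
      if K ≤ (B (t + 1) ∩ side p q (r + 1) a b).ncard then r + 1 else r
    (-move (-x) y (-e.1) e.2.2.1 e.2.2.2, move x y e.2.1 e.2.2.1 e.2.2.2,
      -move (-y) x (-e.2.2.1) e.1 e.2.1, move y x e.2.2.2 e.1 e.2.1)

theorem Advance.large_succ {p q : V → ℤ} {r a b : ℕ → ℤ} {t : ℕ} (h : Advance B K p q r a b t)
    (hc : SideCount p q g c) (hB : B t ⊆ B (t + 1)) (ha : a (t + 1) ≤ a t) (hb : b t ≤ b (t + 1))
    (hl : K ≤ (B t ∩ side p q (r t) (a t) (b t)).ncard) :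
    K ≤ (B (t + 1) ∩ side p q (r (t + 1)) (a (t + 1)) (b (t + 1))).ncard := by
  have fin := (hc.finite (r (t + 1)) (a (t + 1)) (b (t + 1))).subset
    (inter_subset_right (s := B (t + 1)))
  rcases h with ⟨h1, h2⟩ | ⟨h1, -⟩
  · refine h2.trans (ncard_le_ncard ?_ fin)
    rw [h1]
    exact inter_subset_inter_right _ (side_mono ha hb)
  · refine hl.trans (ncard_le_ncard ?_ fin)
    rw [h1]
    exact inter_subset_inter hB (side_mono ha hb)

theorem run_extents (hG : Coordinates G x y g K c) (hs : Spreads G B F) (hg : 1 ≤ g) (hK : K ≤ N)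
    (hN : 1 ≤ N) (h0 : B 0 = rect x y (-N) N (-N) N) :
    Run B K x y (fun t => (extents B K x y N t).1) (fun t => (extents B K x y N t).2.1)
      (fun t => (extents B K x y N t).2.2.1) (fun t => (extents B K x y N t).2.2.2) := by
  have adv (p q : V → ℤ) (r a b : ℕ → ℤ) (t : ℕ)
      (h : r (t + 1) = open Classical in
        if K ≤ (B (t + 1) ∩ side p q (r t + 1) (a t) (b t)).ncard then r t + 1 else r t) :
      Advance B K p q r a b t := by
    unfold Advance
    split_ifs at h with hc
    · exact Or.inl ⟨h, hc⟩
    · exact Or.inr ⟨h, not_le.1 hc⟩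
  set xl := fun t => (extents B K x y N t).1 with hxl
  set xr := fun t => (extents B K x y N t).2.1 with hxr
  set yl := fun t => (extents B K x y N t).2.2.1 with hyl
  set yr := fun t => (extents B K x y N t).2.2.2 with hyr
  have E : ∀ t, Advance B K x y xr yl yr t := fun t => adv _ _ _ _ _ _ rfl
  have W : ∀ t, Advance B K (-x) y (-xl) yl yr t := fun t => adv _ _ _ _ _ _ (neg_neg _)
  have Nn : ∀ t, Advance B K y x yr xl xr t := fun t => adv _ _ _ _ _ _ rfl
  have S : ∀ t, Advance B K (-y) x (-yl) xl xr t := fun t => adv _ _ _ _ _ _ (neg_neg _)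
  have steps : ∀ t, (xl (t + 1) ≤ xl t ∧ xr t ≤ xr (t + 1)) ∧
      (yl (t + 1) ≤ yl t ∧ yr t ≤ yr (t + 1)) := fun t => by
    have e1 := (E t).step
    have e2 := (W t).step
    have e3 := (Nn t).step
    have e4 := (S t).step
    simp only [Pi.neg_apply] at e2 e4
    omega
  have zero : xl 0 = -N ∧ xr 0 = N ∧ yl 0 = -N ∧ yr 0 = N := ⟨rfl, rfl, rfl, rfl⟩
  have lt : ∀ t, xl t < xr t ∧ yl t < yr t := fun t => by
    induction t with
    | zero => omega
    | succ t ih => have := steps t; omega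
  have start_large : ∀ p q : V → ℤ, SideCount p q g c → side p q N (-N) N ⊆ B 0 →
      K ≤ (B 0 ∩ side p q N (-N) N).ncard := fun p q hc hsub => by
    rw [inter_eq_right.2 hsub]
    have h1 := (hc N (-N) N (by omega)).2.2
    have h2 : (N : ℤ) ≤ g * N := le_mul_of_one_le_left (by omega) (by omega)
    have : (K : ℤ) ≤ N := by omega
    have : (K : ℤ) ≤ (side p q N (-N) N).ncard := by linarith
    omega
  refine ⟨fun t => (lt t).1, fun t => (lt t).2, E, W, Nn, S, fun t => ?_, fun t => ?_,
    fun t => ?_, fun t => ?_⟩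
  · induction t with
    | zero =>
      refine start_large x y hG.count_fst ?_
      rw [h0]; intro v hv; simp only [side, rect, mem_ofPred_eq] at *; omega
    | succ t ih =>
      exact (E t).large_succ hG.count_fst (hs.burning_mono t) (steps t).2.1 (steps t).2.2 ih
  · induction t with
    | zero =>
      rw [zero.1, neg_neg]
      refine start_large (-x) y hG.count_fst.neg_fst ?_
      rw [h0]; intro v hv; simp only [side, rect, mem_ofPred_eq, Pi.neg_apply] at *; omega
    | succ t ih =>
      exact (W t).large_succ hG.count_fst.neg_fst (hs.burning_mono t) (steps t).2.1 (steps t).2.2 ih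
  · induction t with
    | zero =>
      refine start_large y x hG.count_snd ?_
      rw [h0]; intro v hv; simp only [side, rect, mem_ofPred_eq] at *; omega
    | succ t ih =>
      exact (Nn t).large_succ hG.count_snd (hs.burning_mono t) (steps t).1.1 (steps t).1.2 ih
  · induction t with
    | zero =>
      rw [zero.2.2.1, neg_neg]
      refine start_large (-y) x hG.count_snd.neg_fst ?_
      rw [h0]; intro v hv; simp only [side, rect, mem_ofPred_eq, Pi.neg_apply] at *; omega
    | succ t ih =>
      exact (S t).large_succ hG.count_snd.neg_fst (hs.burning_mono t) (steps t).1.1 (steps t).1.2 ih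

theorem weight_square_ge (hG : Coordinates G x y g K c) (hN : 1 ≤ N) (F₀ : Finset V) :
    8 * (g * N : ℤ) - 4 * g ≤ 2 * weight (rect x y (-N) N (-N) N) F₀ x y (-N) N (-N) N := by
  set f := frame x y (-N) N (-N) N with hf
  have ffin : f.Finite := (hG.count_fst.rect_finite _ _ _ _).subset inter_subset_left
  have e := (hG.count_fst N (-N) N (by omega)).2.2
  have w := (hG.count_fst (-N) (-N) N (by omega)).2.2
  -- Two of the sides are shortened by one at each end to make the four disjoint; this accounts for
  -- the loss of `4 * g`.
  have n := (hG.count_snd N (-N + 1) (N - 1) (by omega)).2.2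
  have s := (hG.count_snd (-N) (-N + 1) (N - 1) (by omega)).2.2
  have fx := hG.count_fst.finite
  have fy := hG.count_snd.finite
  have hle : (side x y N (-N) N).ncard + (side x y (-N) (-N) N).ncard +
      (side y x N (-N + 1) (N - 1)).ncard + (side y x (-N) (-N + 1) (N - 1)).ncard ≤ f.ncard := by
    rw [← ncard_union_eq ?_ (fx _ _ _) (fx _ _ _), ← ncard_union_eq ?_
      ((fx _ _ _).union (fx _ _ _)) (fy _ _ _), ← ncard_union_eq ?_
      (((fx _ _ _).union (fx _ _ _)).union (fy _ _ _)) (fy _ _ _)]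
    · refine ncard_le_ncard (fun v hv => ?_) ffin
      simp only [hf, frame, rect, side, mem_union, mem_inter_iff, mem_ofPred_eq] at *
      omega
    all_goals
      rw [Set.disjoint_left]
      intro v hv hv'
      simp only [side, mem_union, mem_ofPred_eq] at hv hv'
      omega
  have hw : f.ncard ≤ weight (rect x y (-N) N (-N) N) F₀ x y (-N) N (-N) N := by
    unfold weight
    rw [inter_eq_right.2 (show f ⊆ _ from inter_subset_left)]
    exact Nat.le_add_left _ _
  push_cast [← Int.ofNat_le] at hle hw
  linarith

theorem burning_mono (G : SimpleGraph V) (B₀ : Set V) (F : ℕ → Finset V) :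
    Monotone (burning G B₀ F) :=
  monotone_nat_of_le_succ fun _ => subset_union_left

theorem spreads_burning {B₀ : Set V} {f : ℕ → ℝ} (hF : IsLegalPlay G B₀ f F) :
    Spreads G (burning G B₀ F) F where
  burning_mono _ := subset_union_left
  protected_mono t := hF.mono (Nat.le_succ t)
  spread t u hu v huv := by
    by_cases hv : v ∈ F (t + 1)
    · exact Or.inr hv
    · exact Or.inl (Or.inr ⟨hv, u, hu, huv⟩)

theorem burning_subset_rect (hG : Coordinates G x y g K c) {B₀ : Set V} {N : ℤ}
    (h0 : B₀ ⊆ rect x y (-N) N (-N) N) (t : ℕ) :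
    burning G B₀ F t ⊆ rect x y (-N - t) (N + t) (-N - t) (N + t) := by
  induction t with
  | zero => simpa [burning] using h0
  | succ t ih =>
    rintro v (hv | ⟨-, u, hu, huv⟩)
    · exact rect_mono (by push_cast; omega) (by push_cast; omega) (by push_cast; omega)
        (by push_cast; omega) (ih hv)
    · have h1 := ih hu
      have h2 := abs_le.1 (hG.lip_fst u v huv)
      have h3 := abs_le.1 (hG.lip_snd u v huv)
      simp only [rect, mem_ofPred_eq] at *
      push_cast
      omega

/-- At the rate `3 * g / 2` a large square cannot be contained. -/
theorem Coordinates.exists_not_containable (hG : Coordinates G x y g K c) (hg : 1 ≤ g)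
    (hK : 1 ≤ K) : ∃ B₀ : Set V, B₀.Finite ∧
      ¬ Containable G (fun t => 3 / 2 * (g : ℝ) * t) B₀ := by
  -- This gives 4gN = 24g(1 + c + K) > 20(g + c + K), as `LargeRun.large` demands.
  set N : ℕ := 6 * (1 + c + K) with hN
  refine ⟨rect x y (-N) N (-N) N, hG.count_fst.rect_finite _ _ _ _, ?_⟩
  rintro ⟨F, hF, T, hT⟩
  set B := burning G (rect x y (-N) N (-N) N) F with hB
  have hs := spreads_burning hF
  have hrun := run_extents hG hs hg (N := N) (by omega) (by omega) rfl
  set xl := fun t => (extents B K x y N t).1 with hxl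
  set xr := fun t => (extents B K x y N t).2.1 with hxr
  set yl := fun t => (extents B K x y N t).2.2.1 with hyl
  set yr := fun t => (extents B K x y N t).2.2.2 with hyr
  have hlr : LargeRun G B F g K c N x y xl xr yl yr := by
    refine ⟨hrun, hG, hs, ?_, ?_, weight_square_ge hG (by omega) (F 0), fun t => ?_, ?_⟩
    · change (N : ℤ) - -N = _; ring
    · change (N : ℤ) - -N = _; ring
    · have := hF.budget (t + 1) (by omega)
      have h2 : (2 * ((F (t + 1)).card : ℝ)) ≤ 3 * (g * (t + 1)) := by
        push_cast at this; linarith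
      exact_mod_cast h2
    · rw [hN]; push_cast
      have hg' : (1 : ℤ) ≤ g := by exact_mod_cast hg
      have : (c : ℤ) ≤ g * c := le_mul_of_one_le_left (by omega) hg'
      have : (K : ℤ) ≤ g * K := le_mul_of_one_le_left (by omega) hg'
      nlinarith
  have hper := fun t => (hlr.perimeter_ge (fun t _ => hlr.fast t) t le_rfl).1
  have hmem : ∀ t, ∀ v ∈ B t, v ∈ rect x y (-N - T) (N + T) (-N - T) (N + T) := by
    intro t v hv
    refine burning_subset_rect hG (F := F) subset_rfl T ?_
    rcases le_total T t with h | h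
    · exact (hT t h).subset hv
    · exact burning_mono _ _ _ h hv
  have get : ∀ {S : Set V}, K ≤ S.ncard → S.Nonempty := fun {S} h => by
    rw [nonempty_iff_ne_empty]
    rintro rfl
    rw [ncard_empty] at h; omega
  -- Every front contains a burning vertex, so width plus height never exceeds 4(N + T), yet it is
  -- at least 4N + 3t.
  obtain ⟨t, ht⟩ : ∃ t : ℕ, (t : ℤ) = 4 * (N + T) := ⟨4 * (N + T), by push_cast; ring⟩
  obtain ⟨v1, b1, s1⟩ := get (hrun.east_large t)
  obtain ⟨v2, b2, s2⟩ := get (hrun.west_large t)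
  obtain ⟨v3, b3, s3⟩ := get (hrun.north_large t)
  obtain ⟨v4, b4, s4⟩ := get (hrun.south_large t)
  have m1 := hmem t _ b1
  have m2 := hmem t _ b2
  have m3 := hmem t _ b3
  have m4 := hmem t _ b4
  have p := hper t
  simp only [side, rect, mem_ofPred_eq, Pi.neg_apply] at s1 s2 s3 s4 m1 m2 m3 m4
  omega

end LowerBound

/-! ### Four walls contain the fire at any rate above 3g/2 -/

section UpperBound

variable {V : Type*} {K : ℕ} {x y : V → ℤ} {G : SimpleGraph V} {F : ℕ → Finset V} {g c : ℕ}

theorem exists_forall_eq_of_monotone_of_subset_finite {B : ℕ → Set V} (hB : Monotone B) {S : Set V}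
    (hS : S.Finite) (hBS : ∀ t, B t ⊆ S) : ∃ T, ∀ t, T ≤ t → B t = B T := by
  by_contra! hne
  have key : ∀ n : ℕ, ∃ t, n ≤ (B t).ncard := by
    intro n
    induction n with
    | zero => exact ⟨0, Nat.zero_le _⟩
    | succ n ih =>
      obtain ⟨t, ht⟩ := ih
      obtain ⟨t', htt', h⟩ := hne t
      exact ⟨t', Nat.succ_le_of_lt (ht.trans_lt (ncard_lt_ncard
        ((hB htt').ssubset_of_ne h.symm) (hS.subset (hBS t'))))⟩
  obtain ⟨t, ht⟩ := key (S.ncard + 1)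
  have := ncard_le_ncard (hBS t) hS
  omega

theorem exists_rect_of_finite {B₀ : Set V} (hB : B₀.Finite) (x y : V → ℤ) :
    ∃ N : ℕ, B₀ ⊆ rect x y (-N) N (-N) N := by
  obtain ⟨N, hN⟩ := (hB.image fun v => (x v).natAbs + (y v).natAbs).bddAbove
  refine ⟨N, fun v hv => ?_⟩
  have := hN (mem_image_of_mem _ hv)
  simp only [rect, mem_ofPred_eq]
  omega

/-- The vertices on the boundary of `[-d₃, d₂] × [-d₄, d₁]` at distance at most `s` from the origin
are few, when the distances `d₁ < d₂ < d₃ < d₄` grow quickly. -/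
theorem Coordinates.ncard_frame_inter_le (hG : Coordinates G x y g K c) {d₁ d₂ d₃ d₄ s : ℤ}
    (h₁ : 0 ≤ d₁) (h₁₂ : d₁ < d₂) (h₂₃ : d₂ < d₃) (h₃₄ : d₃ < d₄) {n : ℤ}
    (hn : n = ((frame x y (-d₃) d₂ (-d₄) d₁ ∩ rect x y (-s) s (-s) s).ncard : ℤ)) :
    (s < d₁ ∧ n = 0) ∨ (d₁ ≤ s ∧ 2 * n ≤ 2 * (g * s) + c) ∨
      (d₂ ≤ s ∧ 2 * n ≤ 2 * (g * s) + g * (d₁ + d₂) + 2 * c) ∨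
      (d₃ ≤ s ∧ 2 * n ≤ 2 * (g * s) + g * (2 * d₁ + d₂ + d₃) + 3 * c) ∨
      (d₄ ≤ s ∧ 2 * n ≤ 2 * (g * (d₁ + d₂ + d₃ + d₄)) + 4 * c) := by
  have fx := fun m a b => hG.count_fst.finite m a b
  have fy := fun m a b => hG.count_snd.finite m a b
  have cx := fun m {a b : ℤ} (h : a ≤ b) => (hG.count_fst m a b h).2.1
  have cy := fun m {a b : ℤ} (h : a ≤ b) => (hG.count_snd m a b h).2.1
  rcases lt_or_ge s d₁ with l₁ | l₁
  · refine Or.inl ⟨l₁, ?_⟩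
    rw [hn, Nat.cast_eq_zero, ncard_eq_zero
      ((hG.count_fst.rect_finite _ _ _ _).subset inter_subset_right), eq_empty_iff_forall_notMem]
    intro v hv
    simp only [frame, rect, mem_inter_iff, mem_ofPred_eq] at hv
    omega
  rcases lt_or_ge s d₂ with l₂ | l₂
  · refine Or.inr (Or.inl ⟨l₁, ?_⟩)
    have := ncard_le_ncard (s := frame x y (-d₃) d₂ (-d₄) d₁ ∩ rect x y (-s) s (-s) s)
      (t := side y x d₁ (-s) s) (fun v hv => by
        simp only [frame, rect, side, mem_inter_iff, mem_ofPred_eq] at hv ⊢; omega) (fy _ _ _)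
    have h1 := cy d₁ (a := -s) (b := s) (by omega)
    push_cast [← Int.ofNat_le] at this
    linarith
  rcases lt_or_ge s d₃ with l₃ | l₃
  · refine Or.inr (Or.inr (Or.inl ⟨l₂, ?_⟩))
    have := (ncard_le_ncard (s := frame x y (-d₃) d₂ (-d₄) d₁ ∩ rect x y (-s) s (-s) s)
      (t := side y x d₁ (-s) d₂ ∪ side x y d₂ (-s) d₁) (fun v hv => by
        simp only [frame, rect, side, mem_inter_iff, mem_union, mem_ofPred_eq] at hv ⊢; omega)
      ((fy _ _ _).union (fx _ _ _))).trans (ncard_union_le _ _)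
    have h1 := cy d₁ (a := -s) (b := d₂) (by omega)
    have h2 := cx d₂ (a := -s) (b := d₁) (by omega)
    push_cast [← Int.ofNat_le] at this
    linarith
  rcases lt_or_ge s d₄ with l₄ | l₄
  · refine Or.inr (Or.inr (Or.inr (Or.inl ⟨l₃, ?_⟩)))
    have := (ncard_le_ncard (s := frame x y (-d₃) d₂ (-d₄) d₁ ∩ rect x y (-s) s (-s) s)
      (t := side y x d₁ (-d₃) d₂ ∪ (side x y d₂ (-s) d₁ ∪ side x y (-d₃) (-s) d₁)) (fun v hv => by
        simp only [frame, rect, side, mem_inter_iff, mem_union, mem_ofPred_eq] at hv ⊢; omega)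
      ((fy _ _ _).union ((fx _ _ _).union (fx _ _ _)))).trans ((ncard_union_le _ _).trans
        (Nat.add_le_add_left (ncard_union_le _ _) _))
    have h1 := cy d₁ (a := -d₃) (b := d₂) (by omega)
    have h2 := cx d₂ (a := -s) (b := d₁) (by omega)
    have h3 := cx (-d₃) (a := -s) (b := d₁) (by omega)
    push_cast [← Int.ofNat_le] at this
    linarith
  · refine Or.inr (Or.inr (Or.inr (Or.inr ⟨l₄, ?_⟩)))
    have := (ncard_le_ncard (s := frame x y (-d₃) d₂ (-d₄) d₁ ∩ rect x y (-s) s (-s) s)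
      (t := side y x d₁ (-d₃) d₂ ∪ (side x y d₂ (-d₄) d₁ ∪ (side x y (-d₃) (-d₄) d₁ ∪
        side y x (-d₄) (-d₃) d₂))) (fun v hv => by
        simp only [frame, rect, side, mem_inter_iff, mem_union, mem_ofPred_eq] at hv ⊢; omega)
      ((fy _ _ _).union ((fx _ _ _).union ((fx _ _ _).union (fy _ _ _))))).trans
        ((ncard_union_le _ _).trans (Nat.add_le_add_left ((ncard_union_le _ _).trans
          (Nat.add_le_add_left (ncard_union_le _ _) _)) _))
    have h1 := cy d₁ (a := -d₃) (b := d₂) (by omega)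
    have h2 := cx d₂ (a := -d₄) (b := d₁) (by omega)
    have h3 := cx (-d₃) (a := -d₄) (b := d₁) (by omega)
    have h4 := cy (-d₄) (a := -d₃) (b := d₂) (by omega)
    push_cast [← Int.ofNat_le] at this
    linarith

/-- The four walls can be built in time at any rate above `3 * g / 2`. -/
theorem Coordinates.exists_walls (hG : Coordinates G x y g K c) (hg : 1 ≤ g) {ε : ℝ} (hε : 0 < ε)
    (N : ℕ) : ∃ d₁ d₂ d₃ d₄ : ℤ, N < d₁ ∧ d₁ < d₂ ∧ d₂ < d₃ ∧ d₃ < d₄ ∧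
      ∀ t : ℕ, ((frame x y (-d₃) d₂ (-d₄) d₁ ∩
        rect x y (-(N + t)) (N + t) (-(N + t)) (N + t)).ncard : ℝ) ≤ (3 / 2 * g + ε) * t := by
  -- The fire reaches distance d no earlier than turn d - N; by then the surplus 2εt covers r.
  have pick : ∀ (l : ℤ) (r : ℝ), ∃ d : ℤ, l < d ∧ r ≤ 2 * ε * (d - N) := by
    intro l r
    obtain ⟨k, hk⟩ := exists_nat_ge (r / (2 * ε))
    refine ⟨max (l + 1) (N + k), by omega, ?_⟩
    rw [div_le_iff₀ (by positivity)] at hk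
    have : ((N + k : ℤ) : ℝ) ≤ (max (l + 1) (N + k) : ℤ) := by exact_mod_cast le_max_right _ _
    push_cast at this ⊢
    nlinarith
  obtain ⟨d₁, hd₁⟩ : ∃ d₁ : ℤ, d₁ = 3 * N + c + 1 := ⟨_, rfl⟩
  -- The amount is what remains of twice the cost beyond 3gt, once the term in d₂ is bounded using
  -- d₂ ≤ N + t. The same holds for d₃.
  obtain ⟨d₂, h₁₂, hd₂⟩ := pick d₁ (g * d₁ + 3 * g * N + 2 * c)
  obtain ⟨d₃, h₂₃, hd₃⟩ := pick d₂ (g * d₂ + 2 * g * d₁ + 3 * g * N + 3 * c)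
  -- The complete frame costs about g(d₁ + d₂ + d₃ + d₄), which is below 3g(d₄ - N)/2 for this d₄,
  -- without any help from ε.
  obtain ⟨d₄, hd₄⟩ : ∃ d₄ : ℤ, d₄ = 2 * (d₁ + d₂ + d₃) + 4 * c + 3 * N + 1 := ⟨_, rfl⟩
  refine ⟨d₁, d₂, d₃, d₄, by omega, h₁₂, h₂₃, by omega, fun t => ?_⟩
  have hgr : (1 : ℝ) ≤ g := by exact_mod_cast hg
  have hc0 : (0 : ℝ) ≤ c := by positivity
  have ht0 : (0 : ℝ) ≤ t := by positivity
  have hεt : 0 ≤ ε * t := by positivity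
  have hgt : 0 ≤ (g : ℝ) * t := by positivity
  have hgc : (c : ℝ) ≤ g * c := le_mul_of_one_le_left hc0 hgr
  set n : ℕ := (frame x y (-d₃) d₂ (-d₄) d₁ ∩
    rect x y (-(N + t)) (N + t) (-(N + t)) (N + t)).ncard with hn
  have main := hG.ncard_frame_inter_le (s := N + t) (n := n) (show 0 ≤ d₁ by omega) h₁₂ h₂₃
    (show d₃ < d₄ by omega) (by rw [hn])
  have hd₁' : (d₁ : ℝ) = 3 * N + c + 1 := by exact_mod_cast hd₁
  have hd₄' : (d₄ : ℝ) = 2 * (d₁ + d₂ + d₃) + 4 * c + 3 * N + 1 := by exact_mod_cast hd₄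
  rcases main with ⟨-, h⟩ | ⟨hl, h⟩ | ⟨hl, h⟩ | ⟨hl, h⟩ | ⟨hl, h⟩
  · have : (n : ℝ) = 0 := by exact_mod_cast h
    rw [this]; positivity
  · have hl' : (d₁ : ℝ) ≤ N + t := by exact_mod_cast hl
    have h' : 2 * (n : ℝ) ≤ 2 * (g * (N + t)) + c := by exact_mod_cast h
    have := mul_le_mul_of_nonneg_left hl' (by positivity : (0 : ℝ) ≤ g)
    rw [hd₁'] at this
    linarith
  · have hl' : (d₂ : ℝ) ≤ N + t := by exact_mod_cast hl
    have h' : 2 * (n : ℝ) ≤ 2 * (g * (N + t)) + g * (d₁ + d₂) + 2 * c := by exact_mod_cast h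
    have := mul_le_mul_of_nonneg_left hl' (by positivity : (0 : ℝ) ≤ g)
    have := mul_le_mul_of_nonneg_left hl' hε.le
    linarith
  · have hl' : (d₃ : ℝ) ≤ N + t := by exact_mod_cast hl
    have h' : 2 * (n : ℝ) ≤ 2 * (g * (N + t)) + g * (2 * d₁ + d₂ + d₃) + 3 * c := by
      exact_mod_cast h
    have := mul_le_mul_of_nonneg_left hl' (by positivity : (0 : ℝ) ≤ g)
    have := mul_le_mul_of_nonneg_left hl' hε.le
    linarith
  · have hl' : (d₄ : ℝ) ≤ N + t := by exact_mod_cast hl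
    have h' : 2 * (n : ℝ) ≤ 2 * (g * (d₁ + d₂ + d₃ + d₄)) + 4 * c := by exact_mod_cast h
    have := mul_le_mul_of_nonneg_left hl' (by positivity : (0 : ℝ) ≤ g)
    have e : (g : ℝ) * d₄ = 2 * (g * (d₁ + d₂ + d₃)) + 4 * (g * c) + 3 * (g * N) + g := by
      rw [hd₄']; ring
    linarith

/-- At any rate above `3 * g / 2` every finite fire can be contained. -/
theorem Coordinates.containable (hG : Coordinates G x y g K c) (hg : 1 ≤ g) {ε : ℝ} (hε : 0 < ε)
    {B₀ : Set V} (hB : B₀.Finite) : Containable G (fun t => (3 / 2 * (g : ℝ) + ε) * t) B₀ := by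
  obtain ⟨N, hN⟩ := exists_rect_of_finite hB x y
  obtain ⟨d₁, d₂, d₃, d₄, h₁, h₁₂, h₂₃, h₃₄, hcard⟩ := hG.exists_walls hg hε N
  have fin : ∀ t : ℕ, (frame x y (-d₃) d₂ (-d₄) d₁ ∩
      rect x y (-(N + t)) (N + t) (-(N + t)) (N + t)).Finite := fun t =>
    (hG.count_fst.rect_finite _ _ _ _).subset inter_subset_right
  -- By turn t the fire is confined to the square of radius N + t, so exactly the frame vertices in
  -- that square need protection by then.
  set F : ℕ → Finset V := fun t => (fin t).toFinset with hF
  have memF : ∀ t v, v ∈ F t ↔ v ∈ frame x y (-d₃) d₂ (-d₄) d₁ ∧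
      v ∈ rect x y (-(N + t)) (N + t) (-(N + t)) (N + t) := fun t v => by
    rw [hF, Finite.mem_toFinset, mem_inter_iff]
  refine ⟨F, ⟨?_, ?_, ?_, ?_⟩, ?_⟩
  · ext v
    rw [memF]
    simp only [frame, rect, mem_inter_iff, mem_ofPred_eq, Finset.notMem_empty, iff_false]
    push_cast
    omega
  · intro s t hst v hv
    rw [memF] at hv ⊢
    exact ⟨hv.1, rect_mono (by omega) (by omega) (by omega) (by omega) hv.2⟩
  · intro t v hv hv' hb
    refine hv' ((memF t v).2 ⟨((memF _ v).1 hv).1, ?_⟩)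
    exact rect_mono (by omega) le_rfl (by omega) le_rfl (burning_subset_rect hG hN t hb)
  · intro t _
    rw [← ncard_coe_finset, hF, Finite.coe_toFinset]
    exact hcard t
  · refine exists_forall_eq_of_monotone_of_subset_finite (burning_mono G B₀ F)
      (S := {v | -d₃ < x v ∧ x v < d₂ ∧ -d₄ < y v ∧ y v < d₁})
      ((hG.count_fst.rect_finite (-d₃) d₂ (-d₄) d₁).subset fun v hv => by
        simp only [rect, mem_ofPred_eq] at hv ⊢; omega) fun t => ?_
    induction t with
    | zero =>
      intro v hv
      have := hN hv
      simp only [rect, mem_ofPred_eq] at this ⊢; omega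
    | succ t ih =>
      intro v hv
      have h1 := burning_subset_rect hG hN (t + 1) hv
      rcases hv with hv | ⟨hvF, u, hu, huv⟩
      · exact ih hv
      -- Coordinates change by at most 1 along an edge, so a fire leaving the open rectangle would
      -- enter the frame, at a vertex within range and thus already protected.
      · have h2 := ih hu
        have h3 := abs_le.1 (hG.lip_fst u v huv)
        have h4 := abs_le.1 (hG.lip_snd u v huv)
        rw [memF] at hvF
        simp only [frame, rect, mem_inter_iff, mem_ofPred_eq] at *
        push_cast at *
        omega

theorem Coordinates.isCriticalProtectionRate (hG : Coordinates G x y g K c) (hg : 1 ≤ g)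
    (hK : 1 ≤ K) : IsCriticalProtectionRate G (3 / 2 * (g : ℝ)) :=
  ⟨hG.exists_not_containable hg hK, fun _ hε _ hB => hG.containable hg hε hB⟩

end UpperBound

/-! ### From a plane graph to its strong product with a path -/

section Layers

variable {P : Type*}

/-- The plane version of `SideGrowth`, without a size condition. -/
def PlaneGrowth (H : SimpleGraph P) (p q : P → ℤ) (g : ℕ) : Prop :=
  ∀ (m a b : ℤ) (C : Finset P), a < b → C.Nonempty → (∀ z ∈ C, z ∈ side p q m a b) →
    ∃ D : Finset P, (∀ z ∈ D, z ∈ side p q (m + 1) a b ∧ ∃ u ∈ C, H.Adj u z) ∧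
      (C.filter fun z => a < q z ∧ q z < b).card + g ≤ D.card

/-- Fire reaches layer i of the next side from layer i and the adjacent layers, so layer i receives
at least as much as the interior of each of these, and g more if that interior is nonempty. If two
adjacent layers differ by at least gh, the smaller one alone gains gh and no layer loses. Otherwise
the layer sizes vary slowly; since the set is large, every layer has interior vertices and each
gains g. -/
theorem PlaneGrowth.sideGrowth {H : SimpleGraph P} {p q : P → ℤ} {g : ℕ}
    (hH : PlaneGrowth H p q g) (hinj : ∀ z z', p z = p z' → q z = q z' → z = z') {h : ℕ}
    (hh : 1 ≤ h) :
    SideGrowth (H.strongProd (SimpleGraph.pathGraph h)) (p ∘ Prod.fst) (q ∘ Prod.fst) (g * h)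
      (h * (h * (g * h)) + 2 * h + 1) := by
  classical
  intro m a b A hab hA hK
  have hAfin : A.Finite := finite_of_ncard_pos (by omega)
  set near : Fin h → Fin h → Prop := fun j i =>
    j = i ∨ (SimpleGraph.pathGraph h).Adj j i with hnear
  set S : Fin h → Finset P := fun i => (hAfin.toFinset.filter (·.2 = i)).image Prod.fst with hS
  have memS : ∀ i z, z ∈ S i ↔ (z, i) ∈ A := fun i z => by
    simp only [hS, Finset.mem_image, Finset.mem_filter, Finite.mem_toFinset]
    constructor
    · rintro ⟨⟨z', i'⟩, ⟨h1, rfl⟩, rfl⟩; exact h1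
    · exact fun h => ⟨(z, i), ⟨h, rfl⟩, rfl⟩
  have sideS : ∀ i, ∀ z ∈ S i, z ∈ side p q m a b := fun i z hz => hA ((memS i z).1 hz)
  set S' : Fin h → Finset P := fun i => (S i).filter fun z => a < q z ∧ q z < b with hS'
  have fiber : ∀ (E : Finset (P × Fin h)) (U : Fin h → Finset P),
      (∀ i z, z ∈ U i ↔ (z, i) ∈ E) → E.card = ∑ i, (U i).card := by
    intro E U hU
    rw [Finset.card_eq_sum_card_fiberwise (f := Prod.snd) (t := Finset.univ) (by simp)]
    refine Finset.sum_congr rfl fun i _ => ?_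
    refine Finset.card_bij' (fun v _ => v.1) (fun z _ => (z, i)) ?_ ?_ ?_ ?_
    · rintro ⟨z, j⟩ hv
      obtain ⟨hE, rfl⟩ := Finset.mem_filter.1 hv
      exact (hU _ _).2 hE
    · intro z hz
      exact Finset.mem_filter.2 ⟨(hU _ _).1 hz, rfl⟩
    · rintro ⟨z, j⟩ hv
      obtain ⟨hv, rfl⟩ := Finset.mem_filter.1 hv
      rfl
    · intro z hz; rfl
  have cardA : A.ncard = ∑ i, (S i).card := by
    rw [ncard_eq_toFinset_card A hAfin]
    exact fiber _ _ fun i z => by rw [memS, Finite.mem_toFinset]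
  have cardA' : (A ∩ {v | a < (q ∘ Prod.fst) v ∧ (q ∘ Prod.fst) v < b}).ncard =
      ∑ i, (S' i).card := by
    rw [ncard_eq_toFinset_card _ (hAfin.subset inter_subset_left)]
    refine fiber _ _ fun i z => ?_
    rw [Finite.mem_toFinset, hS', Finset.mem_filter, memS]
    rfl
  set C : Fin h → Finset P := fun i => (Finset.univ.filter fun j => near j i).biUnion S with hC
  have memC : ∀ i z, z ∈ C i ↔ ∃ j, near j i ∧ z ∈ S j := fun i z => by
    simp only [hC, Finset.mem_biUnion, Finset.mem_filter, Finset.mem_univ, true_and]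
  have ex : ∀ i, ∃ D : Finset P, (∀ z ∈ D, z ∈ side p q (m + 1) a b ∧ ∃ u ∈ C i, H.Adj u z) ∧
      (∀ j, near j i → (S' j).card ≤ D.card) ∧
      (∀ j, near j i → (S' j).Nonempty → (S' j).card + g ≤ D.card) := by
    intro i
    have sub : ∀ j, near j i → S' j ⊆ (C i).filter fun z => a < q z ∧ q z < b := fun j hj =>
      Finset.filter_subset_filter _ fun z hz => (memC i z).2 ⟨j, hj, hz⟩
    rcases (C i).eq_empty_or_nonempty with he | hne
    · refine ⟨∅, by simp, fun j hj => ?_, fun j hj hj' => ?_⟩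
      · have := Finset.card_le_card (sub j hj)
        simpa [he] using this
      · have := hj'.mono (sub j hj)
        simp [he] at this
    · obtain ⟨D, hD, hc⟩ := hH m a b (C i) hab hne fun z hz => by
        obtain ⟨j, -, hj⟩ := (memC i z).1 hz
        exact sideS j z hj
      refine ⟨D, hD, fun j hj => ?_, fun j hj _ => ?_⟩
      · have := Finset.card_le_card (sub j hj); omega
      · have := Finset.card_le_card (sub j hj); omega
  choose D hD hD₁ hD₂ using ex
  refine ⟨Finset.univ.biUnion fun i => (D i).image fun z => (z, i), ?_, ?_⟩
  · rintro ⟨z, i⟩ hv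
    simp only [Finset.mem_biUnion, Finset.mem_univ, true_and, Finset.mem_image, Prod.mk.injEq] at hv
    obtain ⟨i, z, hz, rfl, rfl⟩ := hv
    obtain ⟨h1, u, hu, huz⟩ := hD i z hz
    obtain ⟨j, hj, hu⟩ := (memC i u).1 hu
    refine ⟨h1, (u, j), (memS j u).1 hu, ?_, Or.inr huz, hj⟩
    intro e
    exact huz.ne (congrArg Prod.fst e)
  · rw [cardA', fiber _ D fun i z => by simp]
    by_cases hjump : ∃ i j, near j i ∧ (S' i).card + g * h ≤ (S' j).card
    · obtain ⟨i, j, hij, hle⟩ := hjump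
      calc ∑ k, (S' k).card + g * h = ∑ k, ((S' k).card + if k = i then g * h else 0) := by
            rw [Finset.sum_add_distrib]; simp
        _ ≤ ∑ k, (D k).card := by
            refine Finset.sum_le_sum fun k _ => ?_
            split_ifs with hk
            · subst hk; exact hle.trans (hD₁ k j hij)
            · exact hD₁ k k (Or.inl rfl)
    · push Not at hjump
      have lip : ∀ n (i j : Fin h), (j : ℕ) = i + n ∨ (i : ℕ) = j + n →
          (S' j).card ≤ (S' i).card + n * (g * h) := by
        intro n
        induction n with
        | zero =>
          intro i j hij
          have : i = j := Fin.ext (by omega)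
          subst this; simp
        | succ n ih =>
          intro i j hij
          rw [add_mul, one_mul]
          rcases hij with hij | hij
          · have hk : (j : ℕ) - 1 < h := by omega
            have h1 := ih i ⟨j - 1, hk⟩ (by simp only; omega)
            have h2 := hjump ⟨j - 1, hk⟩ j
              (Or.inr (SimpleGraph.pathGraph_adj.2 (by simp only; omega)))
            omega
          · have hk : (j : ℕ) + 1 < h := by omega
            have h1 := ih i ⟨j + 1, hk⟩ (by simp only; omega)
            have h2 := hjump ⟨j + 1, hk⟩ j (Or.inr (SimpleGraph.pathGraph_adj.2 (Or.inl rfl)))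
            omega
      have ends : ∀ i, (S i).card ≤ (S' i).card + 2 := fun i => by
        have one : ∀ e : ℤ, ((S i).filter fun z => q z = e).card ≤ 1 := fun e => by
          refine Finset.card_le_one.2 fun z hz z' hz' => ?_
          rw [Finset.mem_filter] at hz hz'
          exact hinj z z' ((sideS i z hz.1).1.trans (sideS i z' hz'.1).1.symm)
            (hz.2.trans hz'.2.symm)
        have hle : (S i).card ≤ (S' i).card + (((S i).filter fun z => q z = a).card +
            ((S i).filter fun z => q z = b).card) := by
          refine (Finset.card_le_card (t := S' i ∪ (((S i).filter fun z => q z = a) ∪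
            ((S i).filter fun z => q z = b))) fun z hz => ?_).trans ((Finset.card_union_le _ _).trans
            (Nat.add_le_add_left (Finset.card_union_le _ _) _))
          have := sideS i z hz
          simp only [side, mem_ofPred_eq] at this
          simp only [hS', Finset.mem_union, Finset.mem_filter, hz, true_and]
          omega
        have := one a
        have := one b
        omega
      -- Otherwise, with at most two end vertices per layer, the total is at most h(h·gh) + 2h, one
      -- less than the required size.
      have hbig : ∃ i, h * (g * h) < (S' i).card := by
        by_contra! hsmall
        have h1 : ∑ i, (S i).card ≤ ∑ _i : Fin h, (h * (g * h) + 2) :=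
          Finset.sum_le_sum fun i _ => (ends i).trans (Nat.add_le_add_right (hsmall i) 2)
        simp only [Finset.sum_const, Finset.card_univ, Fintype.card_fin, smul_eq_mul] at h1
        rw [mul_add] at h1
        omega
      obtain ⟨i₀, hi₀⟩ := hbig
      have hne : ∀ i, (S' i).Nonempty := fun i => by
        rw [← Finset.card_pos]
        rcases le_total (i : ℕ) i₀ with hi | hi
        · have h1 := lip (i₀ - i) i i₀ (by omega)
          have h2 : ((i₀ : ℕ) - i) * (g * h) ≤ h * (g * h) := Nat.mul_le_mul_right _ (by omega)
          omega
        · have h1 := lip (i - i₀) i i₀ (by omega)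
          have h2 : ((i : ℕ) - i₀) * (g * h) ≤ h * (g * h) := Nat.mul_le_mul_right _ (by omega)
          omega
      calc ∑ k, (S' k).card + g * h = ∑ k, ((S' k).card + g) := by
            rw [Finset.sum_add_distrib]; simp [mul_comm]
        _ ≤ ∑ k, (D k).card :=
            Finset.sum_le_sum fun k _ => hD₂ k k (Or.inl rfl) (hne k)

theorem SideCount.layers {p q : P → ℤ} {g c : ℕ} (hc : SideCount p q g c) (h : ℕ) :
    SideCount (p ∘ (Prod.fst : P × Fin h → P)) (q ∘ Prod.fst) (g * h) (c * h) := by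
  intro m a b hab
  have e : side (p ∘ (Prod.fst : P × Fin h → P)) (q ∘ Prod.fst) m a b =
      side p q m a b ×ˢ (Set.univ : Set (Fin h)) := by
    ext v; simp [side]
  obtain ⟨h1, h2, h3⟩ := hc m a b hab
  rw [e, ncard_prod, ncard_univ, Nat.card_fin]
  refine ⟨h1.prod finite_univ, ?_, ?_⟩
  · have := mul_le_mul_of_nonneg_right h2 (Int.natCast_nonneg h)
    push_cast; linarith
  · have := mul_le_mul_of_nonneg_right h3 (Int.natCast_nonneg h)
    push_cast; linarith

theorem coordinates_layers {H : SimpleGraph P} {x y : P → ℤ} {g c : ℕ}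
    (hx : ∀ u v, H.Adj u v → |x u - x v| ≤ 1) (hy : ∀ u v, H.Adj u v → |y u - y v| ≤ 1)
    (hE : PlaneGrowth H x y g) (hW : PlaneGrowth H (-x) y g) (hN : PlaneGrowth H y x g)
    (hS : PlaneGrowth H (-y) x g) (cx : SideCount x y g c) (cy : SideCount y x g c)
    (hinj : ∀ z z', x z = x z' → y z = y z' → z = z') {h : ℕ} (hh : 1 ≤ h) :
    Coordinates (H.strongProd (SimpleGraph.pathGraph h)) (x ∘ Prod.fst) (y ∘ Prod.fst) (g * h)
      (h * (h * (g * h)) + 2 * h + 1) (c * h) where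
  lip_fst := by
    rintro u v ⟨-, h1 | h1, -⟩
    · simp [h1]
    · exact hx _ _ h1
  lip_snd := by
    rintro u v ⟨-, h1 | h1, -⟩
    · simp [h1]
    · exact hy _ _ h1
  east := hE.sideGrowth hinj hh
  west := hW.sideGrowth (fun z z' h1 h2 => hinj z z' (neg_injective h1) h2) hh
  north := hN.sideGrowth (fun z z' h1 h2 => hinj z z' h2 h1) hh
  south := hS.sideGrowth (fun z z' h1 h2 => hinj z z' h2 (neg_injective h1)) hh
  count_fst := cx.layers h
  count_snd := cy.layers h

end Layers

/-! ### Growth of a side in the plane -/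

section Plane

variable {P : Type*} [AddGroup P] {H : SimpleGraph P} {p q : P → ℤ}

/-- Growth when the steps forward are straight or diagonal. -/
theorem planeGrowth_two {s₀ s₁ s₂ : P} (h₀ : ∀ z, H.Adj z (z + s₀)) (h₁ : ∀ z, H.Adj z (z + s₁))
    (h₂ : ∀ z, H.Adj z (z + s₂)) (p₀ : ∀ z, p (z + s₀) = p z + 1) (p₁ : ∀ z, p (z + s₁) = p z + 1)
    (p₂ : ∀ z, p (z + s₂) = p z + 1) (q₀ : ∀ z, q (z + s₀) = q z) (q₁ : ∀ z, q (z + s₁) = q z + 1)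
    (q₂ : ∀ z, q (z + s₂) = q z - 1) : PlaneGrowth H p q 2 := by
  classical
  intro m a b C hab hC hCs
  simp only [side, mem_ofPred_eq] at hCs ⊢
  set C' := C.filter fun z => a < q z ∧ q z < b with hC'
  have mem' : ∀ z ∈ C', z ∈ C ∧ a < q z ∧ q z < b := fun z hz => Finset.mem_filter.1 hz
  -- If there are no interior vertices, one end vertex already gives two neighbours: one straight
  -- ahead and one diagonally inwards.
  rcases C'.eq_empty_or_nonempty with he | hne
  · obtain ⟨z, hz⟩ := hC
    have hzs := hCs z hz
    have hz' : ¬(a < q z ∧ q z < b) := fun h => by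
      have : z ∈ C' := Finset.mem_filter.2 ⟨hz, h⟩
      simp [he] at this
    have two : ∀ s : P, q (z + s) ≠ q z → ({z + s₀, z + s} : Finset P).card = 2 := fun s hs =>
      Finset.card_pair fun h => hs (by rw [← h, q₀])
    rcases eq_or_ne (q z) a with ha | ha
    · refine ⟨{z + s₀, z + s₁}, ?_, by rw [he, two s₁ (by rw [q₁]; omega)]; simp⟩
      intro w hw
      rw [Finset.mem_insert, Finset.mem_singleton] at hw
      rcases hw with rfl | rfl
      · exact ⟨by rw [p₀, q₀]; omega, z, hz, h₀ z⟩
      · exact ⟨by rw [p₁, q₁]; omega, z, hz, h₁ z⟩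
    · refine ⟨{z + s₀, z + s₂}, ?_, by rw [he, two s₂ (by rw [q₂]; omega)]; simp⟩
      intro w hw
      rw [Finset.mem_insert, Finset.mem_singleton] at hw
      rcases hw with rfl | rfl
      · exact ⟨by rw [p₀, q₀]; omega, z, hz, h₀ z⟩
      · exact ⟨by rw [p₂, q₂]; omega, z, hz, h₂ z⟩
  -- The straight shift preserves the count, and the outward diagonal steps from the two extreme
  -- vertices add one at each end. Starting from interior vertices keeps all of these within `[a,
  -- b]`.
  · obtain ⟨u, hu, hu'⟩ := C'.exists_max_image q hne
    obtain ⟨v, hv, hv'⟩ := C'.exists_min_image q hne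
    refine ⟨insert (u + s₁) (insert (v + s₂) (C'.image (· + s₀))), ?_, ?_⟩
    · intro w hw
      rw [Finset.mem_insert, Finset.mem_insert, Finset.mem_image] at hw
      rcases hw with rfl | rfl | ⟨z, hz, rfl⟩
      · have := mem' u hu
        have := hCs u this.1
        exact ⟨by rw [p₁, q₁]; omega, u, (mem' u hu).1, h₁ u⟩
      · have := mem' v hv
        have := hCs v this.1
        exact ⟨by rw [p₂, q₂]; omega, v, (mem' v hv).1, h₂ v⟩
      · have := mem' z hz
        have := hCs z this.1
        exact ⟨by rw [p₀, q₀]; omega, z, (mem' z hz).1, h₀ z⟩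
    · have hvn : v + s₂ ∉ C'.image (· + s₀) := fun h => by
        obtain ⟨z, hz, hzv⟩ := Finset.mem_image.1 h
        have h1 := congrArg q hzv
        simp only [q₀, q₂] at h1
        have := hv' z hz
        omega
      have hun : u + s₁ ∉ insert (v + s₂) (C'.image (· + s₀)) := fun h => by
        rw [Finset.mem_insert, Finset.mem_image] at h
        rcases h with h | ⟨z, hz, hzu⟩
        · have h1 := congrArg q h
          simp only [q₁, q₂] at h1
          have := hu' v hv
          omega
        · have h1 := congrArg q hzu
          simp only [q₀, q₁] at h1
          have := hu' z hz
          omega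
      rw [Finset.card_insert_of_notMem hun, Finset.card_insert_of_notMem hvn,
        Finset.card_image_of_injective _ (add_left_injective s₀)]

/-- Growth when the steps forward are diagonal. -/
theorem planeGrowth_one {s₁ s₂ : P} (h₁ : ∀ z, H.Adj z (z + s₁))
    (h₂ : ∀ z, H.Adj z (z + s₂)) (p₁ : ∀ z, p (z + s₁) = p z + 1)
    (p₂ : ∀ z, p (z + s₂) = p z + 1) (q₁ : ∀ z, q (z + s₁) = q z + 1)
    (q₂ : ∀ z, q (z + s₂) = q z - 1) : PlaneGrowth H p q 1 := by
  classical
  intro m a b C hab hC hCs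
  simp only [side, mem_ofPred_eq] at hCs ⊢
  set C' := C.filter fun z => a < q z ∧ q z < b with hC'
  have mem' : ∀ z ∈ C', z ∈ C ∧ a < q z ∧ q z < b := fun z hz => Finset.mem_filter.1 hz
  rcases C'.eq_empty_or_nonempty with he | hne
  · obtain ⟨z, hz⟩ := hC
    have hzs := hCs z hz
    rcases eq_or_ne (q z) a with ha | ha
    · refine ⟨{z + s₁}, ?_, by simp [he]⟩
      intro w hw
      obtain rfl := Finset.mem_singleton.1 hw
      exact ⟨by rw [p₁, q₁]; omega, z, hz, h₁ z⟩
    · refine ⟨{z + s₂}, ?_, by simp [he]⟩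
      intro w hw
      obtain rfl := Finset.mem_singleton.1 hw
      exact ⟨by rw [p₂, q₂]; omega, z, hz, h₂ z⟩
  -- All vertices shift along `s₁`; the lowest one, moved along `s₂` instead, falls below the whole
  -- shifted set.
  · obtain ⟨v, hv, hv'⟩ := C'.exists_min_image q hne
    refine ⟨insert (v + s₂) (C'.image (· + s₁)), ?_, ?_⟩
    · intro w hw
      rw [Finset.mem_insert, Finset.mem_image] at hw
      rcases hw with rfl | ⟨z, hz, rfl⟩
      · have := mem' v hv
        have := hCs v this.1
        exact ⟨by rw [p₂, q₂]; omega, v, (mem' v hv).1, h₂ v⟩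
      · have := mem' z hz
        have := hCs z this.1
        exact ⟨by rw [p₁, q₁]; omega, z, (mem' z hz).1, h₁ z⟩
    · have hvn : v + s₂ ∉ C'.image (· + s₁) := fun h => by
        obtain ⟨z, hz, hzv⟩ := Finset.mem_image.1 h
        have h1 := congrArg q hzv
        simp only [q₁, q₂] at h1
        have := hv' z hz
        omega
      rw [Finset.card_insert_of_notMem hvn,
        Finset.card_image_of_injective _ (add_left_injective s₁)]

end Plane

/-! ### Coordinates on the two grids -/

section Grids

theorem sideCount_of_param {P : Type*} {p q : P → ℤ} {g c : ℕ} (l u : ℤ → ℤ → ℤ)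
    (φ : ℤ → ℤ → P) (hφ : ∀ m, Function.Injective (φ m))
    (hside : ∀ m a b, side p q m a b = Set.image (φ m) (Set.Icc (l m a) (u m b)))
    (h₁ : ∀ m a b, a ≤ b → 2 * ((u m b + 1 - l m a).toNat : ℤ) ≤ g * (b - a) + c)
    (h₂ : ∀ m a b, a ≤ b → (g : ℤ) * (b - a) ≤ 2 * ((u m b + 1 - l m a).toNat : ℤ)) :
    SideCount p q g c := by
  intro m a b hab
  have hc : (side p q m a b).ncard = (u m b + 1 - l m a).toNat := by
    rw [hside, ncard_image_of_injective _ (hφ m), ← Finset.coe_Icc, ncard_coe_finset, Int.card_Icc]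
  rw [hc]
  exact ⟨by rw [hside]; exact (Set.finite_Icc _ _).image _, h₁ m a b hab, h₂ m a b hab⟩

theorem intPath_adj {a b : ℤ} : intPath.Adj a b ↔ a + 1 = b ∨ b + 1 = a := by
  rw [SimpleGraph.hasse_adj, Order.covBy_iff_add_one_eq, Order.covBy_iff_add_one_eq]

theorem strongGrid_adj {u v : ℤ × ℤ} : (intPath.strongProd intPath).Adj u v ↔
    u ≠ v ∧ |u.1 - v.1| ≤ 1 ∧ |u.2 - v.2| ≤ 1 := by
  change u ≠ v ∧ (u.1 = v.1 ∨ intPath.Adj u.1 v.1) ∧ (u.2 = v.2 ∨ intPath.Adj u.2 v.2) ↔ _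
  simp only [intPath_adj, abs_le]
  refine and_congr_right fun _ => ?_
  omega

theorem grid_adj {u v : ℤ × ℤ} : (intPath.boxProd intPath).Adj u v ↔
    |u.1 - v.1| + |u.2 - v.2| = 1 := by
  rw [SimpleGraph.boxProd_adj, intPath_adj, intPath_adj]
  rcases abs_cases (u.1 - v.1) with h | h <;> rcases abs_cases (u.2 - v.2) with h' | h' <;> omega

theorem strongGrid_coordinates {h : ℕ} (hh : 1 ≤ h) :
    Coordinates ((intPath.strongProd intPath).strongProd (SimpleGraph.pathGraph h))
      (Prod.fst ∘ Prod.fst) (Prod.snd ∘ Prod.fst) (2 * h) (h * (h * (2 * h)) + 2 * h + 1)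
      (2 * h) := by
  have adj : ∀ s : ℤ × ℤ, s ≠ 0 → |s.1| ≤ 1 → |s.2| ≤ 1 →
      ∀ z, (intPath.strongProd intPath).Adj z (z + s) := fun s h0 h1 h2 z => by
    rw [strongGrid_adj]
    refine ⟨fun e => h0 (left_eq_add.1 e), ?_, ?_⟩ <;> simpa
  refine coordinates_layers (fun u v huv => (strongGrid_adj.1 huv).2.1)
    (fun u v huv => (strongGrid_adj.1 huv).2.2) ?_ ?_ ?_ ?_ ?_ ?_
    (fun z z' h1 h2 => Prod.ext h1 h2) hh
  · refine planeGrowth_two (adj (1, 0) ?_ ?_ ?_) (adj (1, 1) ?_ ?_ ?_) (adj (1, -1) ?_ ?_ ?_)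
      ?_ ?_ ?_ ?_ ?_ ?_ <;> simp [sub_eq_add_neg]
  · refine planeGrowth_two (adj (-1, 0) ?_ ?_ ?_) (adj (-1, 1) ?_ ?_ ?_) (adj (-1, -1) ?_ ?_ ?_)
      ?_ ?_ ?_ ?_ ?_ ?_ <;> simp [sub_eq_add_neg, add_comm]
  · refine planeGrowth_two (adj (0, 1) ?_ ?_ ?_) (adj (1, 1) ?_ ?_ ?_) (adj (-1, 1) ?_ ?_ ?_)
      ?_ ?_ ?_ ?_ ?_ ?_ <;> simp [sub_eq_add_neg]
  · refine planeGrowth_two (adj (0, -1) ?_ ?_ ?_) (adj (1, -1) ?_ ?_ ?_) (adj (-1, -1) ?_ ?_ ?_)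
      ?_ ?_ ?_ ?_ ?_ ?_ <;> simp [sub_eq_add_neg, add_comm]
  · refine sideCount_of_param (fun _ a => a) (fun _ b => b) (fun m i => (m, i))
      (fun m i j e => (Prod.ext_iff.1 e).2) (fun m a b => ?_) (fun m a b hab => ?_)
      (fun m a b hab => ?_)
    · ext ⟨i, j⟩
      simp only [side, mem_ofPred_eq, mem_image, mem_Icc, Prod.mk.injEq]
      exact ⟨fun h => ⟨j, h.2, h.1.symm, rfl⟩, by rintro ⟨k, h, rfl, rfl⟩; exact ⟨rfl, h⟩⟩
    · push_cast; omega
    · push_cast; omega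
  · refine sideCount_of_param (fun _ a => a) (fun _ b => b) (fun m i => (i, m))
      (fun m i j e => (Prod.ext_iff.1 e).1) (fun m a b => ?_) (fun m a b hab => ?_)
      (fun m a b hab => ?_)
    · ext ⟨i, j⟩
      simp only [side, mem_ofPred_eq, mem_image, mem_Icc, Prod.mk.injEq]
      exact ⟨fun h => ⟨i, h.2, rfl, h.1.symm⟩, by rintro ⟨k, h, rfl, rfl⟩; exact ⟨rfl, h⟩⟩
    · push_cast; omega
    · push_cast; omega

/-- In the rotated coordinates every edge of the grid changes both coordinates by ±1. All steps are
therefore diagonal, and a side carries vertices of one parity only; this halves both growth and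
count compared with the strong grid. -/
theorem grid_coordinates {h : ℕ} (hh : 1 ≤ h) :
    Coordinates ((intPath.boxProd intPath).strongProd (SimpleGraph.pathGraph h))
      ((fun z : ℤ × ℤ => z.1 + z.2) ∘ Prod.fst) ((fun z : ℤ × ℤ => z.1 - z.2) ∘ Prod.fst) (1 * h)
      (h * (h * (1 * h)) + 2 * h + 1) (2 * h) := by
  have adj : ∀ s : ℤ × ℤ, |s.1| + |s.2| = 1 →
      ∀ z, (intPath.boxProd intPath).Adj z (z + s) := fun s h0 z => by
    rw [grid_adj]; simpa
  have lip : ∀ u v : ℤ × ℤ, (intPath.boxProd intPath).Adj u v →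
      |u.1 + u.2 - (v.1 + v.2)| ≤ 1 ∧ |u.1 - u.2 - (v.1 - v.2)| ≤ 1 := fun u v huv => by
    rw [grid_adj] at huv
    rw [abs_le, abs_le]
    rcases abs_cases (u.1 - v.1) with h | h <;> rcases abs_cases (u.2 - v.2) with h' | h' <;> omega
  refine coordinates_layers (fun u v huv => (lip u v huv).1) (fun u v huv => (lip u v huv).2)
    ?_ ?_ ?_ ?_ ?_ ?_ (fun z z' h1 h2 => Prod.ext (by omega) (by omega)) hh
  · refine planeGrowth_one (adj (1, 0) (by simp)) (adj (0, 1) (by simp)) ?_ ?_ ?_ ?_ <;>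
      intro z <;> simp <;> ring
  · refine planeGrowth_one (adj (0, -1) (by simp)) (adj (-1, 0) (by simp)) ?_ ?_ ?_ ?_ <;>
      intro z <;> simp <;> ring
  · refine planeGrowth_one (adj (1, 0) (by simp)) (adj (0, -1) (by simp)) ?_ ?_ ?_ ?_ <;>
      intro z <;> simp <;> ring
  · refine planeGrowth_one (adj (0, 1) (by simp)) (adj (-1, 0) (by simp)) ?_ ?_ ?_ ?_ <;>
      intro z <;> simp <;> ring
  -- On the line where the coordinates sum to m, the vertex `(i, m - i)` has difference 2i - m, so i
  -- runs from ⌈(a + m)/2⌉ to ⌊(b + m)/2⌋.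
  · refine sideCount_of_param (fun m a => (a + m + 1) / 2) (fun m b => (b + m) / 2)
      (fun m i => (i, m - i)) (fun m i j e => (Prod.ext_iff.1 e).1) (fun m a b => ?_)
      (fun m a b hab => ?_) (fun m a b hab => ?_)
    · ext ⟨i, j⟩
      simp only [side, mem_ofPred_eq, mem_image, mem_Icc, Prod.mk.injEq]
      exact ⟨fun h => ⟨i, by omega, rfl, by omega⟩, by rintro ⟨k, h, rfl, rfl⟩; omega⟩
    · push_cast; omega
    · push_cast; omega
  · refine sideCount_of_param (fun m a => (a + m + 1) / 2) (fun m b => (b + m) / 2)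
      (fun m i => (i, i - m)) (fun m i j e => (Prod.ext_iff.1 e).1) (fun m a b => ?_)
      (fun m a b hab => ?_) (fun m a b hab => ?_)
    · ext ⟨i, j⟩
      simp only [side, mem_ofPred_eq, mem_image, mem_Icc, Prod.mk.injEq]
      exact ⟨fun h => ⟨i, by omega, rfl, by omega⟩, by rintro ⟨k, h, rfl, rfl⟩; omega⟩
    · push_cast; omega
    · push_cast; omega

end Grids

end Firefighter

theorem mainTheorem3 (h : ℕ) (hh : 1 ≤ h) :
    Firefighter.IsCriticalProtectionRate
        ((Firefighter.intPath.boxProd Firefighter.intPath).strongProd (SimpleGraph.pathGraph h))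
        (3 / 2 * (h : ℝ)) ∧
      Firefighter.IsCriticalProtectionRate
        ((Firefighter.intPath.strongProd Firefighter.intPath).strongProd (SimpleGraph.pathGraph h))
        (3 * (h : ℝ)) := by
  constructor
  · have := (Firefighter.grid_coordinates hh).isCriticalProtectionRate (by omega) (by omega)
    rwa [one_mul] at this
  · have := (Firefighter.strongGrid_coordinates hh).isCriticalProtectionRate (by omega) (by omega)
    convert this using 1
    push_cast; ring
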